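/- Let $X$ be a complex manifold of dimension $n\ge 1$, let $D\subset X$ be an open subset and let $A\subset\partial D$ be open in $\partial D$ (for the induced topology) and a topological hypersurface, i.e. for every $a\in A$ there is a holomorphic chart $(U,\phi)$ around $a$ such that $\phi(A\cap U)$ is a graph $\{(z',x_n+iy_n)\in\mathbb C^n:\ (z',x_n)\in U',\ y_n=h(z',x_n)\}$ of a continuous function $h:U'\to\mathbb R$ on an open set $U'\subset\mathbb C^{n-1}\times\mathbb R$. For an open set $G\subset X$ and $u:G\to[-\infty,\infty)$ put $\hat u=u$ on $G$ and $\hat u(z)=\limsup_{w\in G,\,w\to z}u(w)$ for $z\in\partial G$. If $A\subset\overline G$, let $h_{A,G}$ be the supremum of all plurisubharmonic functions $u$ on $G$ with $u\le 1$ on $G$ and $\hat u\le 0$ on $A$, let $h_{A,G}^{*}$ be its upper semicontinuous regularization on $G$, and let $\omega(z,A,G):=\widehat{h_{A,G}^{*}}(z)$ for $z\in G\cup A$ (the plurisubharmonic measure of $A$ relative to $G$). For $0\le\varepsilon<1$ let $D_\varepsilon:=\{z\in D:\ \omega(z,A,D)<1-\varepsilon\}$. Then: 1. $A$ is an open subset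 of $\partial D_\varepsilon$, and $\lim_{z\to\zeta,\ z\in D\cup A}\omega(z,A,D)=0$ for every $\zeta\in A$. 2. $\omega(z,A,D_\varepsilon)=\dfrac{\omega(z,A,D)}{1-\varepsilon}$ for every $z\in D_\varepsilon$. 3. If $f$ is a holomorphic function on $D_\varepsilon$ with $\lim_{z\to\zeta,\ z\in D_\varepsilon}f(z)=0$ for every $\zeta\in A$, then $f\equiv 0$ on $D_\varepsilon$. -/

import Mathlib

open Set Filter Topology
open scoped Manifold ContDiff

/-- `A` is an open subset of `S` for the topology induced on `S`. -/
def IsRelOpen {X : Type*} [TopologicalSpace X] (A S : Set X) : Prop :=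
  ∃ O : Set X, IsOpen O ∧ A = O ∩ S

/-- A topological hypersurface in `ℂⁿ`, `n = m + 1`: the graph `y_n = h(z', x_n)` of a continuous
real function `h` of `(z', x_n)` on an open set `U ⊆ ℂᵐ × ℝ = ℝ^(2n-1)`. -/
def IsGraphHypersurface {m : ℕ} (S : Set (EuclideanSpace ℂ (Fin (m + 1)))) : Prop :=
  ∃ (U : Set ((Fin m → ℂ) × ℝ)) (h : (Fin m → ℂ) × ℝ → ℝ), IsOpen U ∧ ContinuousOn h U ∧
    S = {z | ((fun i : Fin m => z i.castSucc), (z (Fin.last m)).re) ∈ U ∧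
      (z (Fin.last m)).im = h ((fun i : Fin m => z i.castSucc), (z (Fin.last m)).re)}

/-- A topological hypersurface in a complex manifold of dimension `m + 1`: around each of its points
there is a holomorphic chart carrying it to a topological hypersurface in `ℂ^(m+1)`. -/
def IsTopologicalHypersurface {m : ℕ} {X : Type*} [TopologicalSpace X]
    [ChartedSpace (EuclideanSpace ℂ (Fin (m + 1))) X] (A : Set X) : Prop :=
  ∀ a ∈ A, ∃ e ∈ IsManifold.maximalAtlas 𝓘(ℂ, EuclideanSpace ℂ (Fin (m + 1))) ω X,
    a ∈ e.source ∧ IsGraphHypersurface (e '' (A ∩ e.source))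

/-- The sub-mean value inequality `v(z) ≤ (1/2π) ∫ v(z + e^{iθ} ξ) dθ` on all closed complex discs
`{z + ζ ξ : |ζ| ≤ 1} ⊆ Ω`. Here `v` is meant to be upper semicontinuous with values in `[-∞, ∞)`,
so that the right-hand integral, which may be `-∞`, is the infimum of the integrals of the
continuous real functions on the circle that lie above `ζ ↦ v(z + ζ ξ)`; the inequality is
stated against each of these. -/
def SubMeanOnDiscs {E : Type*} [NormedAddCommGroup E] [NormedSpace ℂ E]
    (v : E → EReal) (Ω : Set E) : Prop :=
  ∀ z ξ : E, (∀ ζ ∈ Metric.closedBall (0 : ℂ) 1, z + ζ • ξ ∈ Ω) →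
    ∀ g : ℂ → ℝ, ContinuousOn g (Metric.sphere (0 : ℂ) 1) →
      (∀ ζ ∈ Metric.sphere (0 : ℂ) 1, v (z + ζ • ξ) ≤ (g ζ : EReal)) →
        v z ≤ ((Real.circleAverage g 0 1 : ℝ) : EReal)

/-- `u` is plurisubharmonic on the open subset `D` of the complex manifold `X` modelled on `E`: it
has values in `[-∞, ∞)`, is upper semicontinuous, and in every holomorphic chart it satisfies the
sub-mean value inequality on complex discs. Only the values of `u` on `D` matter. -/
def IsPlurisubharmonicOn (E : Type*) [NormedAddCommGroup E] [NormedSpace ℂ E]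
    {X : Type*} [TopologicalSpace X] [ChartedSpace E X] (u : X → EReal) (D : Set X) : Prop :=
  (∀ z ∈ D, u z < ⊤) ∧ UpperSemicontinuousOn u D ∧
    ∀ e ∈ IsManifold.maximalAtlas 𝓘(ℂ, E) ω X,
      SubMeanOnDiscs (u ∘ e.symm) (e.target ∩ e.symm ⁻¹' D)

open Classical in
/-- The extension `û` of `u : D → [-∞, ∞)` to boundary points of `D` by the upper limit from within
`D` (only used on the closure of `D`). -/
noncomputable def boundaryExt {X : Type*} [TopologicalSpace X] (D : Set X) (u : X → EReal) (z : X) :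
    EReal :=
  if z ∈ D then u z else limsup u (𝓝[D] z)

/-- `h_{A,D}`: the upper envelope of the plurisubharmonic `u ≤ 1` on `D` with `û ≤ 0` on `A`. -/
noncomputable def extremalFun (E : Type*) [NormedAddCommGroup E] [NormedSpace ℂ E]
    {X : Type*} [TopologicalSpace X] [ChartedSpace E X] (A D : Set X) (z : X) : EReal :=
  sSup {t : EReal | ∃ u : X → EReal, IsPlurisubharmonicOn E u D ∧ (∀ w ∈ D, u w ≤ 1) ∧
    (∀ a ∈ A, boundaryExt D u a ≤ 0) ∧ t = u z}

/-- The upper semicontinuous regularization on `D` of a function on `D`: the upper limit at `z ∈ D`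
of `u(w)` for `w → z`, `w ∈ D`, where `w = z` is allowed. -/
noncomputable def uscReg {X : Type*} [TopologicalSpace X] (D : Set X) (u : X → EReal) (z : X) :
    EReal :=
  limsup u (𝓝[D] z)

/-- The plurisubharmonic measure `ω(z, A, D)` of `A` relative to `D`, for `z ∈ D ∪ A`. -/
noncomputable def pshMeasure (E : Type*) [NormedAddCommGroup E] [NormedSpace ℂ E]
    {X : Type*} [TopologicalSpace X] [ChartedSpace E X] (A D : Set X) (z : X) : EReal :=
  boundaryExt D (uscReg D (extremalFun E A D)) z

/-- The level set `D_ε = {z ∈ D : ω(z, A, D) < 1 - ε}`. -/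
def levelSet (E : Type*) [NormedAddCommGroup E] [NormedSpace ℂ E]
    {X : Type*} [TopologicalSpace X] [ChartedSpace E X] (A D : Set X) (ε : ℝ) : Set X :=
  {z ∈ D | pshMeasure E A D z < ((1 - ε : ℝ) : EReal)}

/-!
The theorem rests on a barrier and on a gluing argument.

*Barrier* (`le_of_mem_slitPlane`, `exists_nhds_forall_le`). On a complex line in the direction of
`z_n` the hypersurface `A` is the graph of a continuous function of `x_n`, so either side of it omits
a vertical half-line ending at any chosen point of the graph. Twice the real part of a suitable
branch of the cube root `(w / R)^(1/3)` of the coordinate centred at that point lies between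
`|w / R|^(1/3)` and `2 |w / R|^(1/3)`. By the maximum principle it dominates on a disc of radius `R`
every plurisubharmonic function that is at most `1` and has boundary values at most `0` on `A`. The
bound is uniform in the competitor, so `ω(·, A, D)` tends to `0` at `A`, and `D` and `D_ε` coincide
near `A`. Applied to `1 + (log |f|) / k` for all `k`, the same bound shows that a holomorphic function
with boundary values `0` on `A` vanishes near `A` (`eventually_eq_zero_of_tendsto_zero`).

*Gluing* (`isPlurisubharmonicOn_glueMax`, `le_extremalFun_of_frontier`). The regularized envelope `ω`
is plurisubharmonic. If `u ≤ k` is plurisubharmonic on an open `G ⊆ D` and `ω ≥ k` on `∂G ∩ D`, then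
`max ω u` on `G`, extended by `ω`, is plurisubharmonic on `D`; when `k ≤ 1` and `u` has boundary
values at most `0` on `A` it is a competitor for `ω`, so `u ≤ ω` on `G`. With `G = D_ε`, `k = 1 - ε`
and `u` a multiple by `1 - ε` of a competitor on `D_ε`, this is the upper bound in the formula for
`ω(·, A, D_ε)`; the lower bound holds because `ω / (1 - ε)` is itself a competitor on `D_ε`. For
the uniqueness statement let `W` be the part of `D_ε` outside the closure of the interior of the zero
set of `f`. The identity theorem gives `∂W ∩ D_ε = ∅`, and `W` stays away from `A`, so that the
constant `1 - ε` is admissible on `G = W`; then `ω ≥ 1 - ε` on `W`, so `W` is empty.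

The sub-mean value inequality is local (`subMeanOnDiscs_of_local`). The usual proof solves the
Dirichlet problem on a disc; here the harmonic majorants are real parts of entire functions, which
approximate every continuous function on the circle (`exists_entire_re_approx`).
-/

/-! ### The sub-mean value inequality on one disc -/

/-- The sub-mean value inequality for `v` at the centre of the single disc `{z + ζ ξ : |ζ| ≤ 1}`,
tested against continuous majorants on the boundary circle. -/
def HasSubMeanAt {E : Type*} [NormedAddCommGroup E] [NormedSpace ℂ E] (v : E → EReal) (z ξ : E) :
    Prop :=
  ∀ g : ℂ → ℝ, ContinuousOn g (Metric.sphere (0 : ℂ) 1) →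
    (∀ ζ ∈ Metric.sphere (0 : ℂ) 1, v (z + ζ • ξ) ≤ (g ζ : EReal)) →
      v z ≤ ((Real.circleAverage g 0 1 : ℝ) : EReal)

theorem circleAverage_re_of_diffContOnCl {F : ℂ → ℂ} (hF : DiffContOnCl ℂ F (Metric.ball 0 1)) :
    Real.circleAverage (fun z => (F z).re) 0 1 = (F 0).re := by
  have hc : ContinuousOn F (Metric.sphere 0 1) := hF.continuousOn.mono (by
    rw [closure_ball _ one_ne_zero]; exact Metric.sphere_subset_closedBall)
  have h1 : CircleIntegrable F 0 1 := hc.circleIntegrable zero_le_one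
  have h2 := Complex.reCLM.circleAverage_comp_comm h1
  have h3 : Real.circleAverage F 0 1 = F 0 := by
    apply DiffContOnCl.circleAverage
    simpa using hF
  rw [h3] at h2
  simpa [Function.comp_def] using h2

/-- Real parts of trigonometric polynomials are boundary values of real parts of holomorphic
polynomials. -/
theorem exists_entire_re_of_mem_span_fourier {f : C(AddCircle (1 : ℝ), ℂ)}
    (hf : f ∈ Submodule.span ℂ (range (@fourier 1))) (c : ℂ) :
    ∃ F : ℂ → ℂ, Differentiable ℂ F ∧ ∀ x, (c * f x).re = (F (AddCircle.toCircle x)).re := by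
  induction hf using Submodule.span_induction generalizing c with
  | mem f hf =>
    obtain ⟨n, rfl⟩ := hf
    obtain ⟨k, rfl | rfl⟩ := n.eq_nat_or_neg
    · refine ⟨fun z => c * z ^ k, by fun_prop, fun x => ?_⟩
      simp [fourier_apply, AddCircle.toCircle_nsmul]
    · -- On the circle `c z⁻ᵏ` is the conjugate of `c̄ zᵏ`.
      refine ⟨fun z => (starRingEnd ℂ) c * z ^ k, by fun_prop, fun x => ?_⟩
      rw [← Complex.conj_re (c * _), map_mul, ← fourier_neg, neg_neg]
      simp [fourier_apply, AddCircle.toCircle_nsmul]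
  | zero => exact ⟨0, differentiable_const 0, by simp⟩
  | add f₁ f₂ _ _ h₁ h₂ =>
    obtain ⟨F₁, hF₁, e₁⟩ := h₁ c
    obtain ⟨F₂, hF₂, e₂⟩ := h₂ c
    exact ⟨F₁ + F₂, hF₁.add hF₂, fun x => by simp [mul_add, ← e₁, ← e₂]⟩
  | smul a f _ h =>
    obtain ⟨F, hF, e⟩ := h (c * a)
    exact ⟨F, hF, fun x => by rw [← e]; simp [mul_assoc]⟩

/-- Continuous functions on the circle are approximated uniformly from above by real parts of entire
functions, because trigonometric polynomials are dense. This replaces the Poisson integral in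
comparisons with harmonic functions. -/
theorem exists_entire_re_approx {g : ℂ → ℝ} (hg : ContinuousOn g (Metric.sphere (0 : ℂ) 1))
    {δ : ℝ} (hδ : 0 < δ) :
    ∃ F : ℂ → ℂ, Differentiable ℂ F ∧
      ∀ ζ ∈ Metric.sphere (0 : ℂ) 1, g ζ ≤ (F ζ).re ∧ (F ζ).re ≤ g ζ + δ := by
  have : Fact (0 < (1 : ℝ)) := ⟨one_pos⟩
  have hgc : Continuous fun x : AddCircle (1 : ℝ) => ((g (AddCircle.toCircle x) : ℝ) : ℂ) := by
    refine Complex.continuous_ofReal.comp (hg.comp_continuous ?_ ?_)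
    · exact continuous_subtype_val.comp AddCircle.continuous_toCircle
    · intro x; exact (AddCircle.toCircle x).2
  let G : C(AddCircle (1 : ℝ), ℂ) := ⟨_, hgc⟩
  have hmem : G ∈ (Submodule.span ℂ (range (@fourier 1))).topologicalClosure := by
    rw [span_fourier_closure_eq_top]; trivial
  have hmem' : G ∈ closure ((Submodule.span ℂ (range (@fourier 1)) :
      Submodule ℂ C(AddCircle (1 : ℝ), ℂ)) : Set C(AddCircle (1 : ℝ), ℂ)) := hmem
  obtain ⟨f, hf, hdist⟩ := Metric.mem_closure_iff.1 hmem' (δ / 2) (by positivity)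
  obtain ⟨F, hF, e⟩ := exists_entire_re_of_mem_span_fourier hf 1
  refine ⟨fun z => F z + (δ / 2 : ℝ), hF.add_const _, fun ζ hζ => ?_⟩
  obtain ⟨x, hx⟩ := (AddCircle.homeomorphCircle (T := (1 : ℝ)) one_ne_zero).surjective
    ⟨ζ, by simpa [Submonoid.unitSphere] using hζ⟩
  have hx' : (AddCircle.toCircle x : ℂ) = ζ := by
    have := congrArg (fun c : Circle => (c : ℂ)) hx
    rwa [AddCircle.homeomorphCircle_apply] at this
  have h1 : dist (G x) (f x) < δ / 2 := (ContinuousMap.dist_apply_le_dist x).trans_lt hdist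
  have h2 : |(G x - f x).re| < δ / 2 :=
    (Complex.abs_re_le_norm _).trans_lt (by rwa [← dist_eq_norm])
  have h3 : (G x).re = g ζ := by simp [G, hx']
  have h4 : (f x).re = (F ζ).re := by rw [← hx', ← e]; simp
  rw [Complex.sub_re, h3, h4, abs_lt] at h2
  simp only [Complex.add_re, Complex.ofReal_re]
  constructor <;> linarith [h2.1, h2.2]

section

variable {E : Type*} [NormedAddCommGroup E] [NormedSpace ℂ E] {v : E → EReal} {z ξ : E}

/-- The sub-mean value inequality may be tested on real parts of entire functions only. -/
theorem hasSubMeanAt_of_entire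
    (h : ∀ F : ℂ → ℂ, Differentiable ℂ F →
      (∀ ζ ∈ Metric.sphere (0 : ℂ) 1, v (z + ζ • ξ) ≤ ((F ζ).re : EReal)) →
        v z ≤ ((F 0).re : EReal)) : HasSubMeanAt v z ξ := by
  intro g hg hle
  refine EReal.le_of_forall_lt_iff_le.1 fun t ht => ?_
  have ht' : Real.circleAverage g 0 1 < t := by exact_mod_cast ht
  obtain ⟨F, hF, hFg⟩ := exists_entire_re_approx hg (sub_pos.2 ht')
  refine (h F hF fun ζ hζ => (hle ζ hζ).trans (by exact_mod_cast (hFg ζ hζ).1)).trans ?_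
  have hgi : CircleIntegrable g 0 1 := hg.circleIntegrable zero_le_one
  have h1 : Real.circleAverage (fun z => (F z).re) 0 1 ≤
      Real.circleAverage (fun z => g z + (t - Real.circleAverage g 0 1)) 0 1 := by
    apply Real.circleAverage_mono
    · exact (Complex.continuous_re.comp hF.continuous).continuousOn.circleIntegrable zero_le_one
    · exact hgi.add (circleIntegrable_const _ _ _)
    · intro ζ hζ
      exact (hFg ζ (by simpa using hζ)).2
  rw [circleAverage_re_of_diffContOnCl hF.diffContOnCl,
    Real.circleAverage_fun_add hgi (circleIntegrable_const _ _ _), Real.circleAverage_const] at h1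
  have : (F 0).re ≤ t := by linarith
  exact_mod_cast this

theorem HasSubMeanAt.le_re (h : HasSubMeanAt v z ξ) {F : ℂ → ℂ}
    (hF : DiffContOnCl ℂ F (Metric.ball 0 1))
    (hle : ∀ ζ ∈ Metric.sphere (0 : ℂ) 1, v (z + ζ • ξ) ≤ ((F ζ).re : EReal)) :
    v z ≤ ((F 0).re : EReal) := by
  rw [← circleAverage_re_of_diffContOnCl hF]
  refine h _ (Complex.continuous_re.comp_continuousOn (hF.continuousOn.mono ?_)) hle
  rw [closure_ball _ one_ne_zero]
  exact Metric.sphere_subset_closedBall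

theorem HasSubMeanAt.comp_line {ζ₀ ρ : ℂ} (h : HasSubMeanAt v (z + ζ₀ • ξ) (ρ • ξ)) :
    HasSubMeanAt (fun ζ : ℂ => v (z + ζ • ξ)) ζ₀ ρ := by
  intro g hg hle
  refine h g hg fun ζ hζ => ?_
  convert hle ζ hζ using 2
  rw [add_smul, smul_smul, smul_eq_mul, add_assoc]

end

/-! ### The maximum principle in the plane -/

/-- Maximum principle: an upper semicontinuous function with the local sub-mean value property
on a bounded plane open set lies below the real part of a holomorphic function once it does so
asymptotically at the boundary. -/
theorem le_re_of_frontier_le {G : Set ℂ} (hG : IsOpen G) (hb : Bornology.IsBounded G)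
    {v : ℂ → EReal} (hv : UpperSemicontinuousOn v G) (hlt : ∀ z ∈ G, v z < ⊤)
    (hsub : ∀ z ∈ G, ∃ r : ℝ, 0 < r ∧ Metric.closedBall z r ⊆ G ∧ HasSubMeanAt v z (r : ℂ))
    {F : ℂ → ℂ} (hF : DifferentiableOn ℂ F G)
    (hbd : ∀ p ∈ frontier G, ∀ δ : ℝ, 0 < δ →
      ∀ᶠ w in 𝓝[G] p, v w ≤ (((F w).re + δ : ℝ) : EReal)) :
    ∀ w ∈ G, v w ≤ ((F w).re : EReal) := by
  intro w₀ hw₀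
  by_contra hcon
  rw [not_le] at hcon
  obtain ⟨t, ht, htv⟩ := EReal.lt_iff_exists_real_btwn.1 hcon
  have ht' : (F w₀).re < t := by exact_mod_cast ht
  obtain ⟨R, hR, hRb⟩ := hb.exists_pos_norm_le
  set δ := (t - (F w₀).re) / 2 with hδdef
  have hδ : 0 < δ := by simp only [hδdef]; linarith
  set η := δ / (2 * R ^ 2) with hηdef
  have hη : 0 < η := by positivity
  -- The perturbation `η |w|²` makes the inequality strict at an interior maximum.
  set φ : ℂ → ℝ := fun w => η * Complex.normSq w - (F w).re with hφdef
  have hφc : ContinuousOn φ G := by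
    apply ContinuousOn.sub
    · exact (continuous_const.mul Complex.continuous_normSq).continuousOn
    · exact Complex.continuous_re.comp_continuousOn hF.continuousOn
  set s : ℂ → EReal := fun w => v w + (φ w : EReal) with hsdef
  have hs : UpperSemicontinuousOn s G := by
    apply UpperSemicontinuousOn.add' hv
    · exact (continuous_coe_real_ereal.comp_continuousOn hφc).upperSemicontinuousOn
    · intro x hx
      exact EReal.continuousAt_add (Or.inr (EReal.coe_ne_bot _)) (Or.inr (EReal.coe_ne_top _))
  set K : Set ℂ := {w ∈ G | ((2 * δ : ℝ) : EReal) ≤ s w} with hK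
  have hw₀K : w₀ ∈ K := by
    refine ⟨hw₀, ?_⟩
    have h1 : ((2 * δ : ℝ) : EReal) ≤ ((t + φ w₀ : ℝ) : EReal) := by
      have := Complex.normSq_nonneg w₀
      have h0 : 0 ≤ η * Complex.normSq w₀ := by positivity
      norm_cast
      simp only [hφdef, hδdef]; linarith
    refine h1.trans ?_
    rw [EReal.coe_add]
    exact add_le_add htv.le le_rfl
  have hηR : ∀ w ∈ G, η * Complex.normSq w ≤ δ / 2 := by
    intro w hw
    have h1 : Complex.normSq w ≤ R ^ 2 := by
      rw [Complex.normSq_eq_norm_sq]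
      exact pow_le_pow_left₀ (norm_nonneg _) (hRb w hw) 2
    calc η * Complex.normSq w ≤ η * R ^ 2 := by gcongr
      _ = δ / 2 := by rw [hηdef]; field_simp
  have hKc : IsClosed K := by
    refine isClosed_of_closure_subset fun p hp => ?_
    have hpG : p ∈ closure G := closure_mono (fun _ h => h.1) hp
    have hfreq : ∃ᶠ w in 𝓝 p, w ∈ K := mem_closure_iff_frequently.1 hp
    by_cases hpin : p ∈ G
    · refine ⟨hpin, ?_⟩
      by_contra hlt'
      rw [not_le] at hlt'
      have h1 := upperSemicontinuousOn_iff.1 hs p hpin _ hlt'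
      rw [hG.nhdsWithin_eq hpin] at h1
      exact hfreq (h1.mono fun w hw hwK => (not_le.2 hw) hwK.2)
    · exfalso
      have hfr : p ∈ frontier G := by rw [hG.frontier_eq]; exact ⟨hpG, hpin⟩
      have h1 := hbd p hfr (δ / 2) (by positivity)
      rw [eventually_nhdsWithin_iff] at h1
      refine hfreq (h1.mono fun w hw hwK => ?_)
      have h2 : s w ≤ (((F w).re + δ / 2 + φ w : ℝ) : EReal) := by
        rw [EReal.coe_add]
        exact add_le_add (hw hwK.1) le_rfl
      have h3 := hwK.2.trans h2
      have h4 : 2 * δ ≤ (F w).re + δ / 2 + φ w := by exact_mod_cast h3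
      have := hηR w hwK.1
      simp only [hφdef] at h4
      linarith
  have hKcomp : IsCompact K := Metric.isCompact_of_isClosed_isBounded hKc (hb.subset fun _ h => h.1)
  obtain ⟨z₁, hz₁, hmax⟩ := (hs.mono fun _ h => h.1).exists_isMaxOn ⟨w₀, hw₀K⟩ hKcomp
  have hle : ∀ w ∈ G, s w ≤ s z₁ := by
    intro w hw
    by_cases hwK : w ∈ K
    · exact hmax hwK
    · have : s w < ((2 * δ : ℝ) : EReal) := by
        by_contra h; exact hwK ⟨hw, not_lt.1 h⟩
      exact this.le.trans hz₁.2
  have hvbot : v z₁ ≠ ⊥ := by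
    intro hbot
    have := hz₁.2
    simp only [hsdef, hbot, EReal.bot_add] at this
    exact absurd this (not_le.2 (EReal.bot_lt_coe _))
  obtain ⟨c, hc⟩ : ∃ c : ℝ, v z₁ = c := ⟨(v z₁).toReal, by
    rw [EReal.coe_toReal (hlt z₁ hz₁.1).ne hvbot]⟩
  obtain ⟨r, hr, hball, hmean⟩ := hsub z₁ hz₁.1
  have hmaps : MapsTo (fun ζ : ℂ => z₁ + (r : ℂ) * ζ) (Metric.closedBall 0 1) G := by
    intro ζ hζ
    apply hball
    rw [mem_closedBall_iff_norm] at hζ ⊢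
    simp only [add_sub_cancel_left, norm_mul, Complex.norm_real, Real.norm_eq_abs, abs_of_pos hr]
    rw [sub_zero] at hζ
    nlinarith
  have hFd : DiffContOnCl ℂ (fun ζ : ℂ => ((c + φ z₁ - η * (Complex.normSq z₁ + r * r) : ℝ) : ℂ) +
      F (z₁ + (r : ℂ) * ζ) - ((2 * η * r : ℝ) : ℂ) * (starRingEnd ℂ z₁) * ζ) (Metric.ball 0 1) := by
    apply DifferentiableOn.diffContOnCl
    rw [closure_ball _ one_ne_zero]
    refine DifferentiableOn.sub (DifferentiableOn.add (by fun_prop) ?_) (by fun_prop)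
    exact hF.comp (by fun_prop) hmaps
  have hfin := hmean.le_re hFd (fun ζ hζ => by
    have hmem : z₁ + (r : ℂ) * ζ ∈ G := hmaps (Metric.sphere_subset_closedBall hζ)
    have h1 := hle _ hmem
    have h2 : s z₁ = ((c + φ z₁ : ℝ) : EReal) := by simp [hsdef, hc]
    rw [h2] at h1
    have h3 : v (z₁ + ζ • (r : ℂ)) ≤ ((c + φ z₁ - φ (z₁ + r * ζ) : ℝ) : EReal) := by
      rw [smul_eq_mul, mul_comm ζ, EReal.coe_sub]
      exact EReal.le_sub_iff_add_le (Or.inl (EReal.coe_ne_bot _))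
        (Or.inl (EReal.coe_ne_top _)) |>.2 h1
    refine h3.trans (le_of_eq ?_)
    norm_cast
    have h4 : Complex.normSq ζ = 1 := by
      rw [Complex.normSq_eq_norm_sq, mem_sphere_zero_iff_norm.1 hζ, one_pow]
    have h5 : Complex.normSq (z₁ + r * ζ) =
        Complex.normSq z₁ + r * r + (((2 * r : ℝ) : ℂ) * (starRingEnd ℂ z₁) * ζ).re := by
      rw [Complex.normSq_add, Complex.normSq_mul, h4, Complex.normSq_ofReal]
      simp
      ring
    simp only [hφdef, h5]
    simp
    ring)
  rw [hc] at hfin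
  have h6 : c ≤ c + φ z₁ - η * (Complex.normSq z₁ + r * r) + (F z₁).re := by
    have : c ≤ _ := EReal.coe_le_coe_iff.1 hfin
    simpa using this
  have : 0 < η * (r * r) := by positivity
  simp only [hφdef] at h6
  linarith

/-- The sub-mean value inequality on small discs implies it on all discs. -/
theorem subMeanOnDiscs_of_local {E : Type*} [NormedAddCommGroup E] [NormedSpace ℂ E]
    {v : E → EReal} {Ω : Set E} (hv : UpperSemicontinuousOn v Ω)
    (hlt : ∀ z ∈ Ω, v z < ⊤)
    (hloc : ∀ z ∈ Ω, ∃ r : ℝ, 0 < r ∧ ∀ ξ : E, ‖ξ‖ ≤ r → HasSubMeanAt v z ξ) :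
    SubMeanOnDiscs v Ω := by
  intro z ξ hdisc
  refine hasSubMeanAt_of_entire fun F hF hle => ?_
  have hcl : Continuous fun ζ : ℂ => z + ζ • ξ := by fun_prop
  have husc : UpperSemicontinuousOn (fun ζ : ℂ => v (z + ζ • ξ)) (Metric.closedBall 0 1) :=
    UpperSemicontinuousOn.comp hv hcl.continuousOn hdisc
  have key := le_re_of_frontier_le (G := Metric.ball 0 1) Metric.isOpen_ball Metric.isBounded_ball
    (v := fun ζ : ℂ => v (z + ζ • ξ)) (husc.mono Metric.ball_subset_closedBall)
    (fun ζ hζ => hlt _ (hdisc ζ (Metric.ball_subset_closedBall hζ))) ?_ hF.differentiableOn ?_ 0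
    (Metric.mem_ball_self one_pos)
  · simpa using key
  · intro ζ hζ
    obtain ⟨r, hr, hmean⟩ := hloc _ (hdisc ζ (Metric.ball_subset_closedBall hζ))
    obtain ⟨ρ', hρ', hρball⟩ := Metric.nhds_basis_closedBall.mem_iff.1
      (Metric.isOpen_ball.mem_nhds hζ)
    have hpos : 0 < r / (‖ξ‖ + 1) := by positivity
    refine ⟨min ρ' (r / (‖ξ‖ + 1)), lt_min hρ' hpos,
      (Metric.closedBall_subset_closedBall (min_le_left _ _)).trans hρball,
      (hmean _ ?_).comp_line⟩
    rw [norm_smul, Complex.norm_real, Real.norm_eq_abs, abs_of_pos (lt_min hρ' hpos)]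
    calc min ρ' (r / (‖ξ‖ + 1)) * ‖ξ‖ ≤ r / (‖ξ‖ + 1) * (‖ξ‖ + 1) := by
          gcongr
          · exact min_le_right _ _
          · linarith
      _ = r := by field_simp
  · intro p hp δ hδ
    rw [frontier_ball _ one_ne_zero] at hp
    have hpc := Metric.sphere_subset_closedBall hp
    have h1 : v (z + p • ξ) < (((F p).re + δ / 2 : ℝ) : EReal) :=
      (hle p hp).trans_lt (by norm_cast; linarith)
    have h2 := upperSemicontinuousOn_iff.1 husc p hpc _ h1
    have h3 : ∀ᶠ w in 𝓝 p, (F p).re - δ / 2 < (F w).re :=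
      ((Complex.continuous_re.comp hF.continuous).tendsto p).eventually_const_lt (by
        simp only [Function.comp]; linarith)
    filter_upwards [nhdsWithin_mono p Metric.ball_subset_closedBall h2,
      nhdsWithin_le_nhds h3] with w hw2 hw3
    refine hw2.le.trans ?_
    norm_cast
    linarith

/-! ### Stability of the sub-mean value inequality -/

theorem EReal.coe_mul_le_coe_iff {c : ℝ} (hc : 0 < c) {a : EReal} {t : ℝ} :
    (c : EReal) * a ≤ t ↔ a ≤ ((c⁻¹ * t : ℝ) : EReal) := by
  have hc' : (0 : EReal) < c := by exact_mod_cast hc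
  rw [mul_comm, ← EReal.le_div_iff_mul_le hc' (EReal.coe_ne_top _), ← EReal.coe_div,
    div_eq_inv_mul]

section

variable {E : Type*} [NormedAddCommGroup E] [NormedSpace ℂ E] {u v : E → EReal} {z ξ : E}

theorem HasSubMeanAt.of_le (h : HasSubMeanAt u z ξ) (hz : v z ≤ u z)
    (hle : ∀ ζ ∈ Metric.sphere (0 : ℂ) 1, u (z + ζ • ξ) ≤ v (z + ζ • ξ)) : HasSubMeanAt v z ξ :=
  fun g hg hv => hz.trans (h g hg fun ζ hζ => (hle ζ hζ).trans (hv ζ hζ))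

theorem HasSubMeanAt.max (hu : HasSubMeanAt u z ξ) (hv : HasSubMeanAt v z ξ) :
    HasSubMeanAt (fun w => max (u w) (v w)) z ξ := by
  rcases le_total (u z) (v z) with h | h
  · exact hv.of_le (by simp [h]) fun _ _ => le_max_right _ _
  · exact hu.of_le (by simp [h]) fun _ _ => le_max_left _ _

theorem hasSubMeanAt_const (c : ℝ) : HasSubMeanAt (fun _ : E => (c : EReal)) z ξ := by
  intro g hg hle
  have : Real.circleAverage (fun _ => c) 0 1 ≤ Real.circleAverage g 0 1 := by
    apply Real.circleAverage_mono (circleIntegrable_const _ _ _)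
      (hg.circleIntegrable zero_le_one)
    intro ζ hζ
    exact EReal.coe_le_coe_iff.1 (hle ζ (by simpa using hζ))
  rw [Real.circleAverage_const] at this
  exact EReal.coe_le_coe_iff.2 this

theorem HasSubMeanAt.const_mul (h : HasSubMeanAt v z ξ) {c : ℝ} (hc : 0 < c) :
    HasSubMeanAt (fun w => (c : EReal) * v w) z ξ := by
  intro g hg hle
  rw [EReal.coe_mul_le_coe_iff hc]
  have h1 := h (fun ζ => c⁻¹ * g ζ) (continuousOn_const.mul hg) fun ζ hζ => (EReal.coe_mul_le_coe_iff hc).1 (hle ζ hζ)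
  have h2 : Real.circleAverage (fun ζ => c⁻¹ * g ζ) 0 1 = c⁻¹ * Real.circleAverage g 0 1 :=
    Real.circleAverage_fun_smul (a := c⁻¹) (f := g)
  rwa [h2] at h1

theorem add_smul_mem_closedBall {r : ℝ} (hξ : ‖ξ‖ ≤ r) {ζ : ℂ}
    (hζ : ζ ∈ Metric.closedBall (0 : ℂ) 1) : z + ζ • ξ ∈ Metric.closedBall z r := by
  rw [mem_closedBall_zero_iff] at hζ
  rw [mem_closedBall_iff_norm, add_sub_cancel_left, norm_smul]
  nlinarith [norm_nonneg ζ, norm_nonneg ξ]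

end

/-! ### Upper semicontinuous regularization -/

theorem upperSemicontinuousOn_uscReg {X : Type*} [TopologicalSpace X] {D : Set X}
    (u : X → EReal) : UpperSemicontinuousOn (uscReg D u) D := by
  rw [upperSemicontinuousOn_iff]
  intro z _ y hy
  obtain ⟨y', hy', hlt⟩ := exists_between hy
  have h1 : ∀ᶠ w in 𝓝[D] z, u w < y' := eventually_lt_of_limsup_lt hy'
  filter_upwards [eventually_eventually_nhdsWithin.2 h1] with w hw
  exact (limsup_le_of_le (h := hw.mono fun _ h => h.le)).trans_lt hlt

theorem le_uscReg {X : Type*} [TopologicalSpace X] {D : Set X} (u : X → EReal) {z : X}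
    (hz : z ∈ D) : u z ≤ uscReg D u z :=
  le_limsup_of_frequently_le (frequently_iff.2 fun hU => ⟨z, mem_of_mem_nhdsWithin hz hU, le_rfl⟩)

theorem uscReg_le {X : Type*} [TopologicalSpace X] {D : Set X} {u : X → EReal} {c : EReal}
    (h : ∀ z ∈ D, u z ≤ c) (z : X) : uscReg D u z ≤ c :=
  limsup_le_of_le (h := eventually_nhdsWithin_of_forall h)

/-! ### Plurisubharmonic functions on manifolds -/

theorem OpenPartialHomeomorph.isOpen_target_inter_symm_preimage {X E : Type*} [TopologicalSpace X]
    [TopologicalSpace E] (e : OpenPartialHomeomorph X E) {D : Set X}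
    (hD : IsOpen D) : IsOpen (e.target ∩ e.symm ⁻¹' D) :=
  e.symm.isOpen_inter_preimage hD

theorem upperSemicontinuousOn_comp_symm {X E : Type*} [TopologicalSpace X]
    [TopologicalSpace E] (e : OpenPartialHomeomorph X E) {D : Set X} {u : X → EReal}
    (hu : UpperSemicontinuousOn u D) :
    UpperSemicontinuousOn (u ∘ e.symm) (e.target ∩ e.symm ⁻¹' D) :=
  UpperSemicontinuousOn.comp hu (e.continuousOn_symm.mono inter_subset_left) fun _ h => h.2

open Classical in
/-- The function that is `max s u` on `G` and `s` elsewhere. Values of `u` off `G` do not matter. -/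
noncomputable def glueMax {X : Type*} (G : Set X) (s u : X → EReal) (z : X) : EReal :=
  if z ∈ G then max (s z) (u z) else s z

theorem le_glueMax {X : Type*} (G : Set X) (s u : X → EReal) (z : X) : s z ≤ glueMax G s u z := by
  unfold glueMax; split_ifs <;> simp

theorem le_glueMax_of_mem {X : Type*} {G : Set X} (s u : X → EReal) {z : X} (hz : z ∈ G) :
    u z ≤ glueMax G s u z := by
  simp [glueMax, hz]

section

variable {E : Type*} [NormedAddCommGroup E] [NormedSpace ℂ E]
  {X : Type*} [TopologicalSpace X] [ChartedSpace E X] {D : Set X} {u v : X → EReal}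

/-- On an open set the sub-mean value inequality need only be checked on small discs. -/
theorem isPlurisubharmonicOn_of_local (hD : IsOpen D) (hlt : ∀ z ∈ D, u z < ⊤)
    (husc : UpperSemicontinuousOn u D)
    (hloc : ∀ e ∈ IsManifold.maximalAtlas 𝓘(ℂ, E) ω X, ∀ z ∈ e.target ∩ e.symm ⁻¹' D,
      ∃ r : ℝ, 0 < r ∧ ∀ ξ : E, ‖ξ‖ ≤ r →
        (∀ ζ ∈ Metric.closedBall (0 : ℂ) 1, z + ζ • ξ ∈ e.target ∩ e.symm ⁻¹' D) →
        HasSubMeanAt (u ∘ e.symm) z ξ) : IsPlurisubharmonicOn E u D := by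
  refine ⟨hlt, husc, fun e he => subMeanOnDiscs_of_local (upperSemicontinuousOn_comp_symm e husc)
    (fun z hz => hlt _ hz.2) fun z hz => ?_⟩
  obtain ⟨r, hr, hball⟩ := Metric.nhds_basis_closedBall.mem_iff.1
    ((e.isOpen_target_inter_symm_preimage hD).mem_nhds hz)
  obtain ⟨r', hr', h⟩ := hloc e he z hz
  exact ⟨min r r', lt_min hr hr', fun ξ hξ => h ξ (hξ.trans (min_le_right _ _)) fun ζ hζ =>
    hball (add_smul_mem_closedBall (hξ.trans (min_le_left _ _)) hζ)⟩

theorem isPlurisubharmonicOn_const (c : ℝ) :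
    IsPlurisubharmonicOn E (fun _ : X => (c : EReal)) D :=
  ⟨fun _ _ => EReal.coe_lt_top c, upperSemicontinuousOn_const,
    fun _ _ z ξ _ => hasSubMeanAt_const (E := E) (z := z) (ξ := ξ) c⟩

theorem IsPlurisubharmonicOn.mono (hu : IsPlurisubharmonicOn E u D) {G : Set X} (hG : G ⊆ D) :
    IsPlurisubharmonicOn E u G :=
  ⟨fun z hz => hu.1 z (hG hz), hu.2.1.mono hG, fun e he z ξ hd =>
    hu.2.2 e he z ξ fun ζ hζ => ⟨(hd ζ hζ).1, hG (hd ζ hζ).2⟩⟩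

theorem IsPlurisubharmonicOn.const_mul (hu : IsPlurisubharmonicOn E u D) {c : ℝ} (hc : 0 < c) :
    IsPlurisubharmonicOn E (fun z => (c : EReal) * u z) D := by
  have hc' : (0 : EReal) < c := by exact_mod_cast hc
  refine ⟨fun z hz => ?_, ?_, fun e he z ξ hd =>
    HasSubMeanAt.const_mul (v := u ∘ e.symm) (hu.2.2 e he z ξ hd) hc⟩
  · rw [lt_top_iff_ne_top]
    intro h
    rw [EReal.mul_eq_top] at h
    have := (hu.1 z hz).ne
    have h0 : ¬ (c : EReal) < 0 := not_lt.2 hc'.le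
    simp_all
  · have hcont : Continuous fun a : EReal => (c : EReal) * a := by
      refine continuous_iff_continuousAt.2 fun a => ?_
      refine (EReal.continuousAt_mul (p := ((c : EReal), a)) (Or.inl hc'.ne') (Or.inl hc'.ne')
        (Or.inl (EReal.coe_ne_bot _)) (Or.inl (EReal.coe_ne_top _))).comp
        (f := fun a : EReal => ((c : EReal), a)) ?_
      exact Continuous.continuousAt (by fun_prop)
    exact hcont.comp_upperSemicontinuousOn hu.2.1
      fun a b hab => mul_le_mul_of_nonneg_left hab hc'.le

/-- Gluing: if `u ≤ k ≤ s` at the boundary of `G` inside `D`, then `max s u` on `G`, extended by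
`s`, is plurisubharmonic on `D`. -/
theorem isPlurisubharmonicOn_glueMax (hD : IsOpen D) {G : Set X} (hG : IsOpen G)
    {s : X → EReal} (hs : IsPlurisubharmonicOn E s D) (hu : IsPlurisubharmonicOn E u G)
    {k : EReal} (huk : ∀ z ∈ G, u z ≤ k) (hsk : ∀ z ∈ D, z ∈ frontier G → k ≤ s z) :
    IsPlurisubharmonicOn E (glueMax G s u) D := by
  have hlt : ∀ z ∈ D, glueMax G s u z < ⊤ := by
    intro z hz
    unfold glueMax
    split_ifs with h
    · exact max_lt (hs.1 z hz) (hu.1 z h)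
    · exact hs.1 z hz
  refine isPlurisubharmonicOn_of_local hD hlt ?_ ?_
  · rw [upperSemicontinuousOn_iff]
    intro z hz y hy
    have h1 := upperSemicontinuousOn_iff.1 hs.2.1 z hz y ((le_glueMax G s u z).trans_lt hy)
    by_cases hzG : z ∈ G
    · have h2 := upperSemicontinuousOn_iff.1 hu.2.1 z hzG y ((le_glueMax_of_mem s u hzG).trans_lt hy)
      rw [hG.nhdsWithin_eq hzG] at h2
      filter_upwards [h1, nhdsWithin_le_nhds h2] with w hw1 hw2
      unfold glueMax
      split_ifs
      exacts [max_lt hw1 hw2, hw1]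
    · by_cases hzc : z ∈ closure G
      · have hk : k < y := (hsk z hz (by rw [hG.frontier_eq]; exact ⟨hzc, hzG⟩)).trans_lt
          ((le_glueMax G s u z).trans_lt hy)
        filter_upwards [h1] with w hw1
        unfold glueMax
        split_ifs with hw
        exacts [max_lt hw1 ((huk w hw).trans_lt hk), hw1]
      · filter_upwards [h1, nhdsWithin_le_nhds (isClosed_closure.isOpen_compl.mem_nhds hzc)]
          with w hw1 hw2
        have : w ∉ G := fun h => hw2 (subset_closure h)
        simpa [glueMax, this] using hw1
  · intro e he z hz
    by_cases hzG : e.symm z ∈ G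
    · obtain ⟨r, hr, hball⟩ := Metric.nhds_basis_closedBall.mem_iff.1
        ((e.isOpen_target_inter_symm_preimage hG).mem_nhds ⟨hz.1, hzG⟩)
      refine ⟨r, hr, fun ξ hξ hΩ => ?_⟩
      have h1 : HasSubMeanAt (s ∘ e.symm) z ξ := hs.2.2 e he z ξ hΩ
      have h2 : HasSubMeanAt (u ∘ e.symm) z ξ := hu.2.2 e he z ξ fun ζ hζ =>
        hball (add_smul_mem_closedBall hξ hζ)
      refine (h1.max h2).of_le (by simp [glueMax, hzG]) fun ζ hζ => ?_
      have := (hball (add_smul_mem_closedBall hξ (Metric.sphere_subset_closedBall hζ))).2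
      simp only [mem_preimage] at this
      simp [glueMax, this]
    · refine ⟨1, one_pos, fun ξ hξ hΩ => ?_⟩
      have h1 : HasSubMeanAt (s ∘ e.symm) z ξ := hs.2.2 e he z ξ hΩ
      exact h1.of_le (by simp [glueMax, hzG]) fun ζ hζ => le_glueMax G s u _

/-- The regularized upper envelope of a family of plurisubharmonic functions that is bounded above
is plurisubharmonic. -/
theorem isPlurisubharmonicOn_uscReg (hD : IsOpen D) {S : Set (X → EReal)} {h : X → EReal} {M : ℝ}
    (hS : ∀ u ∈ S, IsPlurisubharmonicOn E u D) (hM : ∀ z ∈ D, h z ≤ M)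
    (hh : ∀ z, IsLUB ((fun u : X → EReal => u z) '' S) (h z)) :
    IsPlurisubharmonicOn E (uscReg D h) D := by
  have hmain := upperSemicontinuousOn_uscReg (D := D) h
  refine ⟨fun z _ => (uscReg_le hM z).trans_lt (EReal.coe_lt_top M), hmain, ?_⟩
  intro e he z ξ hdisc
  refine hasSubMeanAt_of_entire fun F hF hle => ?_
  have hopen := e.isOpen_target_inter_symm_preimage hD
  have hcont : Continuous fun p : E × ℂ => p.1 + p.2 • ξ := by fun_prop
  refine EReal.le_of_forall_lt_iff_le.1 fun t ht => ?_
  have ht' : (F 0).re < t := by exact_mod_cast ht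
  set δ := t - (F 0).re with hδ
  have hδ0 : 0 < δ := sub_pos.2 ht'
  -- By compactness of the disc and upper semicontinuity, the strict bounds on the circle persist
  -- for centres `z'` near `z`; this controls the upper limit that defines the regularization.
  have hsub : ∀ᶠ z' in 𝓝 z, ∀ ζ ∈ Metric.closedBall (0 : ℂ) 1,
      z' + ζ • ξ ∈ e.target ∩ e.symm ⁻¹' D := by
    refine (isCompact_closedBall (0 : ℂ) 1).eventually_forall_of_forall_eventually fun ζ hζ => ?_
    exact (hcont.tendsto (z, ζ)).eventually (hopen.mem_nhds (hdisc ζ hζ))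
  have hcirc : ∀ᶠ z' in 𝓝 z, ∀ ζ ∈ Metric.sphere (0 : ℂ) 1,
      uscReg D h (e.symm (z' + ζ • ξ)) ≤ (((F ζ).re + δ : ℝ) : EReal) := by
    refine (isCompact_sphere (0 : ℂ) 1).eventually_forall_of_forall_eventually fun ζ hζ => ?_
    have hmem := hdisc ζ (Metric.sphere_subset_closedBall hζ)
    have h1 := upperSemicontinuousOn_iff.1 (upperSemicontinuousOn_comp_symm e hmain) _ hmem
      (((F ζ).re + δ / 2 : ℝ) : EReal)
      ((hle ζ hζ).trans_lt (by norm_cast; linarith))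
    rw [hopen.nhdsWithin_eq hmem] at h1
    have h2 : ∀ᶠ w in 𝓝 ζ, (F ζ).re - δ / 2 < (F w).re :=
      ((Complex.continuous_re.comp hF.continuous).tendsto ζ).eventually_const_lt (by
        simp only [Function.comp]; linarith)
    filter_upwards [(hcont.tendsto (z, ζ)).eventually h1,
      (continuous_snd.tendsto (z, ζ)).eventually h2] with p hp1 hp2
    refine hp1.le.trans ?_
    norm_cast
    linarith
  have hz : z ∈ e.target ∩ e.symm ⁻¹' D := by
    simpa using hdisc 0 (Metric.mem_closedBall_self zero_le_one)
  have hsrc : e.symm z ∈ e.source := e.map_target hz.1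
  have hev : ∀ᶠ z' in 𝓝 z, h (e.symm z') ≤ (t : EReal) := by
    filter_upwards [hsub, hcirc] with z' h1 h2
    refine (hh _).2 ?_
    rintro _ ⟨u, hu, rfl⟩
    have h3 : HasSubMeanAt (u ∘ e.symm) z' ξ := (hS u hu).2.2 e he z' ξ h1
    have h4 := h3.le_re (F := fun ζ => F ζ + (δ : ℂ)) (hF.add_const _).diffContOnCl fun ζ hζ => by
      have hmem := (h1 ζ (Metric.sphere_subset_closedBall hζ)).2
      have h5 : u (e.symm (z' + ζ • ξ)) ≤ h (e.symm (z' + ζ • ξ)) := (hh _).1 ⟨u, hu, rfl⟩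
      simpa using (h5.trans (le_uscReg h hmem)).trans (h2 ζ hζ)
    have h6 : (F 0 + (δ : ℂ)).re = t := by simp [hδ]
    rw [h6] at h4
    exact h4
  have hev' : ∀ᶠ x in 𝓝 (e.symm z), h x ≤ (t : EReal) := by
    have h1 : Tendsto e (𝓝 (e.symm z)) (𝓝 z) := by
      have := e.continuousAt hsrc
      rwa [ContinuousAt, e.right_inv hz.1] at this
    filter_upwards [h1.eventually hev, e.open_source.mem_nhds hsrc] with x hx1 hx2
    rwa [e.left_inv hx2] at hx1
  exact limsup_le_of_le (h := nhdsWithin_le_nhds hev')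

end

theorem ENNReal.log_enorm_le_coe_iff {a : ℂ} {r : ℝ} :
    ENNReal.log ‖a‖ₑ ≤ (r : EReal) ↔ ‖a‖ ≤ Real.exp r := by
  have h : (r : EReal) = ENNReal.log (ENNReal.ofReal (Real.exp r)) := by
    rw [ENNReal.log_ofReal_of_pos (Real.exp_pos r), Real.log_exp]
  rw [h, ENNReal.log_le_log_iff, ← ofReal_norm,
    ENNReal.ofReal_le_ofReal_iff (Real.exp_pos r).le]

section

variable {E : Type*} [NormedAddCommGroup E] [NormedSpace ℂ E]
  {X : Type*} [TopologicalSpace X] [ChartedSpace E X] {D : Set X}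

theorem MDifferentiableOn.differentiableOn_comp_symm {f : X → ℂ}
    (hf : MDifferentiableOn 𝓘(ℂ, E) 𝓘(ℂ) f D) {e : OpenPartialHomeomorph X E}
    (he : e ∈ IsManifold.maximalAtlas 𝓘(ℂ, E) ω X) :
    DifferentiableOn ℂ (f ∘ e.symm) (e.target ∩ e.symm ⁻¹' D) := by
  rw [← mdifferentiableOn_iff_differentiableOn]
  have h1 : MDifferentiableOn 𝓘(ℂ, E) 𝓘(ℂ, E) e.symm e.target :=
    (contMDiffOn_symm_of_mem_maximalAtlas he).mdifferentiableOn (by simp)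
  exact hf.comp (h1.mono inter_subset_left) fun _ h => h.2

/-- The logarithm of the modulus of a holomorphic function is plurisubharmonic. -/
theorem isPlurisubharmonicOn_log_enorm {f : X → ℂ} (hf : MDifferentiableOn 𝓘(ℂ, E) 𝓘(ℂ) f D) :
    IsPlurisubharmonicOn E (fun z => ENNReal.log ‖f z‖ₑ) D := by
  refine ⟨fun z _ => by simp, ?_, fun e he z ξ hdisc => hasSubMeanAt_of_entire fun P hP hle => ?_⟩
  · exact (ENNReal.continuous_log.comp_continuousOn
      (continuous_enorm.comp_continuousOn hf.continuousOn)).upperSemicontinuousOn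
  · -- Apply the maximum modulus principle to `f e^{-P}` on the disc.
    have hd : DiffContOnCl ℂ (fun ζ : ℂ => (f ∘ e.symm) (z + ζ • ξ) * Complex.exp (-P ζ))
        (Metric.ball 0 1) := by
      apply DifferentiableOn.diffContOnCl
      rw [closure_ball _ one_ne_zero]
      refine DifferentiableOn.mul ?_ (by fun_prop)
      exact (hf.differentiableOn_comp_symm he).comp (by fun_prop) hdisc
    have h0 := Complex.norm_le_of_forall_mem_frontier_norm_le Metric.isBounded_ball hd (C := 1)
      (fun ζ hζ => by
        rw [frontier_ball _ one_ne_zero] at hζ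
        have h1 := ENNReal.log_enorm_le_coe_iff.1 (hle ζ hζ)
        rw [norm_mul, Complex.norm_exp, Complex.neg_re, Real.exp_neg]
        exact (mul_inv_le_iff₀ (Real.exp_pos _)).2 (by simpa using h1))
      (subset_closure (Metric.mem_ball_self one_pos))
    rw [norm_mul, Complex.norm_exp, Complex.neg_re, Real.exp_neg,
      mul_inv_le_iff₀ (Real.exp_pos _), one_mul, zero_smul, add_zero] at h0
    exact ENNReal.log_enorm_le_coe_iff.2 h0

end

/-! ### The barrier at a topological hypersurface -/

/-- Quantitative barrier in the plane: the cube root of a coordinate omitting a slit is a holomorphic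
function whose real part is comparable to the cube root of the distance to the tip of the slit. -/
theorem le_of_mem_slitPlane {G : Set ℂ} (hG : IsOpen G) {R : ℝ} (hR : 0 < R)
    (hGR : G ⊆ Metric.ball 0 R) {κ : ℂ} (hκ : ‖κ‖ = 1) (hslit : ∀ w ∈ G, κ * w ∈ Complex.slitPlane)
    {v : ℂ → EReal} (hv : UpperSemicontinuousOn v G) (hv1 : ∀ w ∈ G, v w ≤ 1)
    (hsub : ∀ z ∈ G, ∃ r : ℝ, 0 < r ∧ Metric.closedBall z r ⊆ G ∧ HasSubMeanAt v z (r : ℂ))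
    (hbd : ∀ p ∈ frontier G, ‖p‖ < R → ∀ δ : ℝ, 0 < δ → ∀ᶠ w in 𝓝[G] p, v w ≤ (δ : EReal))
    {η : ℝ} (hη : 0 < η) {w : ℂ} (hw : w ∈ G) (hwη : ‖w‖ ≤ R * (η / 2) ^ 3) :
    v w ≤ (η : EReal) := by
  set F : ℂ → ℂ := fun w => ((2 : ℝ) : ℂ) * Complex.exp (Complex.log (κ * w / (R : ℂ)) / 3) with hF
  have hslit' : ∀ w ∈ G, κ * w / (R : ℂ) ∈ Complex.slitPlane := fun w hw => by
    have h := hslit w hw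
    rw [Complex.mem_slitPlane_iff] at h ⊢
    rw [Complex.div_ofReal_re, Complex.div_ofReal_im]
    rcases h with h | h
    · exact Or.inl (by positivity)
    · exact Or.inr (by positivity)
  have hFd : DifferentiableOn ℂ F G := by
    refine DifferentiableOn.const_mul (DifferentiableOn.cexp (DifferentiableOn.div_const
      (DifferentiableOn.clog (by fun_prop) hslit') 3)) _
  have hre : ∀ w, (F w).re = 2 * (Real.exp (Real.log (‖w‖ / R) / 3) *
      Real.cos (Complex.arg (κ * w / (R : ℂ)) / 3)) := by
    intro w
    have h3 : ∀ z : ℂ, z / 3 = z / ((3 : ℝ) : ℂ) := fun z => by norm_num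
    simp only [hF]
    rw [Complex.re_ofReal_mul, Complex.exp_re, h3, Complex.div_ofReal_re, Complex.div_ofReal_im,
      Complex.log_re, Complex.log_im, norm_div, norm_mul, hκ, one_mul, Complex.norm_real,
      Real.norm_of_nonneg hR.le]
  -- The angle is at most `π / 3`, which keeps the real part away from `0` up to the slit.
  have hcos : ∀ z : ℂ, 1 / 2 ≤ Real.cos (Complex.arg z / 3) := by
    intro z
    have h1 := Complex.abs_arg_le_pi z
    rw [← Real.cos_pi_div_three, ← Real.cos_abs (Complex.arg z / 3)]
    apply Real.cos_le_cos_of_nonneg_of_le_pi (abs_nonneg _)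
    · linarith [Real.pi_pos]
    · rw [abs_div, abs_of_pos (by norm_num : (0 : ℝ) < 3)]
      linarith
  have hlow : ∀ w, Real.exp (Real.log (‖w‖ / R) / 3) ≤ (F w).re := by
    intro w
    rw [hre]
    nlinarith [Real.exp_pos (Real.log (‖w‖ / R) / 3), hcos (κ * w / (R : ℂ))]
  have hmain := le_re_of_frontier_le hG (Metric.isBounded_ball.subset hGR) hv
    (fun z hz => (hv1 z hz).trans_lt (by exact_mod_cast EReal.coe_lt_top 1)) hsub hFd ?_ w hw
  · refine hmain.trans ?_
    norm_cast
    have hw0 : w ≠ 0 := by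
      rintro rfl
      simpa using hslit _ hw
    have h1 : Real.log (‖w‖ / R) / 3 ≤ Real.log (η / 2) := by
      have h2 : Real.log (‖w‖ / R) ≤ Real.log ((η / 2) ^ 3) := by
        apply Real.log_le_log (by positivity)
        rw [div_le_iff₀ hR, mul_comm]
        exact hwη
      rw [Real.log_pow] at h2
      push_cast at h2
      linarith
    have h2 : Real.exp (Real.log (‖w‖ / R) / 3) ≤ η / 2 := by
      rw [← Real.exp_log (by positivity : 0 < η / 2)]
      exact Real.exp_le_exp.2 h1
    rw [hre]
    nlinarith [Real.exp_pos (Real.log (‖w‖ / R) / 3),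
      Real.cos_le_one (Complex.arg (κ * w / (R : ℂ)) / 3)]
  · intro p hp δ hδ
    have hpR : ‖p‖ ≤ R := by
      have h1 := closure_mono hGR hp.1
      rw [closure_ball _ hR.ne'] at h1
      simpa using h1
    rcases hpR.lt_or_eq with hlt | heq
    · filter_upwards [hbd p hp hlt δ hδ] with w hw
      refine hw.trans ?_
      norm_cast
      linarith [hlow w, Real.exp_pos (Real.log (‖w‖ / R) / 3)]
    · have hc : ContinuousAt (fun w : ℂ => Real.exp (Real.log (‖w‖ / R) / 3)) p := by
        refine (ContinuousAt.div_const (ContinuousAt.log (by fun_prop) ?_) 3).rexp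
        rw [heq, div_self hR.ne']
        exact one_ne_zero
      have h1 : 1 - δ < Real.exp (Real.log (‖p‖ / R) / 3) := by
        rw [heq, div_self hR.ne']
        simpa using hδ
      filter_upwards [nhdsWithin_le_nhds (hc.eventually_const_lt h1), self_mem_nhdsWithin]
        with w hw hwG
      refine (hv1 w hwG).trans ?_
      have h2 : (1 : ℝ) ≤ (F w).re + δ := by linarith [hlow w]
      exact_mod_cast h2

section

variable {m : ℕ} {X : Type*} [TopologicalSpace X]
  [ChartedSpace (EuclideanSpace ℂ (Fin (m + 1))) X]

/-- Uniform boundary estimate: near a point of a topological hypersurface in the boundary,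
plurisubharmonic functions that are at most `1` and have boundary values at most `0` on the
hypersurface are uniformly small. It is proved on complex lines in the direction of `z_n`: such a
line meets the hypersurface in the graph of a continuous function, so that each side of it omits
a vertical half-line ending at any given point of the graph. -/
theorem exists_nhds_forall_le {D A : Set X} (hD : IsOpen D) (hA : IsRelOpen A (frontier D))
    (hA' : IsTopologicalHypersurface (m := m) A) {a : X} (ha : a ∈ A) {N : Set X} (hN : IsOpen N)
    (haN : a ∈ N) {η : ℝ} (hη : 0 < η) :
    ∃ N₁ ∈ 𝓝 a, ∀ u : X → EReal,
      IsPlurisubharmonicOn (EuclideanSpace ℂ (Fin (m + 1))) u (D ∩ N) →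
      (∀ z ∈ D ∩ N, u z ≤ 1) →
      (∀ b ∈ A ∩ N, ∀ δ : ℝ, 0 < δ → ∀ᶠ z in 𝓝[D] b, u z ≤ (δ : EReal)) →
      ∀ z ∈ D ∩ N₁, u z ≤ (η : EReal) := by
  obtain ⟨O, hO, hAO⟩ := hA
  have hAfr : ∀ x ∈ A, x ∉ D := by
    intro x hx
    rw [hAO, hD.frontier_eq] at hx
    exact hx.2.2
  obtain ⟨e, he, hae, U, h, hU, hh, hS⟩ := hA' a ha
  set proj : EuclideanSpace ℂ (Fin (m + 1)) → (Fin m → ℂ) × ℝ :=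
    fun z => ((fun i : Fin m => z i.castSucc), (z (Fin.last m)).re) with hproj
  have hprojc : Continuous proj := by fun_prop
  set en : EuclideanSpace ℂ (Fin (m + 1)) := EuclideanSpace.single (Fin.last m) 1 with hen
  have hen_norm : ‖en‖ = 1 := by simp [hen]
  have hlast : ∀ (z : EuclideanSpace ℂ (Fin (m + 1))) (w : ℂ),
      (z + w • en) (Fin.last m) = z (Fin.last m) + w := fun z w => by simp [hen]
  have hproj_add : ∀ (z : EuclideanSpace ℂ (Fin (m + 1))) (w : ℂ), w.re = 0 →
      proj (z + w • en) = proj z := by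
    intro z w hw
    simp only [hproj, hlast, Complex.add_re, hw, add_zero, Prod.mk.injEq, and_true]
    funext i
    simp [hen, (Fin.castSucc_lt_last i).ne]
  have hSA : ∀ z, z ∈ e.target → proj z ∈ U → (z (Fin.last m)).im = h (proj z) →
      e.symm z ∈ A := by
    intro z _ hzU hz
    have : z ∈ e '' (A ∩ e.source) := by rw [hS]; exact ⟨hzU, hz⟩
    obtain ⟨x, hx, rfl⟩ := this
    rw [e.left_inv hx.2]
    exact hx.1
  have hpS : proj (e a) ∈ U ∧ ((e a) (Fin.last m)).im = h (proj (e a)) := by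
    have : e a ∈ e '' (A ∩ e.source) := ⟨a, ⟨ha, hae⟩, rfl⟩
    rw [hS] at this
    exact this
  have haO : a ∈ O := by rw [hAO] at ha; exact ha.1
  set T := (e.target ∩ e.symm ⁻¹' (O ∩ N)) ∩ proj ⁻¹' U with hT
  have hTo : IsOpen T :=
    (e.isOpen_target_inter_symm_preimage (hO.inter hN)).inter (hU.preimage hprojc)
  have hpT : e a ∈ T := ⟨⟨e.map_source hae, by simp [e.left_inv hae, haO, haN]⟩, hpS.1⟩
  obtain ⟨R', hR', hball⟩ := Metric.isOpen_iff.1 hTo _ hpT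
  obtain ⟨R, hR, hRR⟩ : ∃ R : ℝ, 0 < R ∧ R' = 2 * R := ⟨R' / 2, by positivity, by ring⟩
  subst hRR
  -- `τ` is the height above the hypersurface.
  set τ : EuclideanSpace ℂ (Fin (m + 1)) → ℝ :=
    fun z => (z (Fin.last m)).im - h (proj z) with hτ
  have hτU : ContinuousOn τ (proj ⁻¹' U) := by
    refine ContinuousOn.sub (Continuous.continuousOn (by fun_prop)) ?_
    exact hh.comp hprojc.continuousOn fun _ h => h
  have hτc : ContinuousAt τ (e a) := hτU.continuousAt ((hU.preimage hprojc).mem_nhds hpS.1)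
  have hτ0 : τ (e a) = 0 := by simp [hτ, hpS.2]
  have hqc : ContinuousAt (fun z => z - ((τ z : ℂ) * Complex.I) • en) (e a) :=
    continuousAt_id.sub (((Complex.continuous_ofReal.continuousAt.comp hτc).mul
      continuousAt_const).smul continuousAt_const)
  have hev : ∀ᶠ z in 𝓝 (e a), |τ z| < min R (R * (η / 2) ^ 3) ∧
      z - ((τ z : ℂ) * Complex.I) • en ∈ Metric.ball (e a) R ∧ proj z ∈ U := by
    refine (hτc.abs.eventually_lt_const ?_).and ((hqc.eventually_mem ?_).and
      ((hU.preimage hprojc).mem_nhds hpS.1))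
    · simp only [hτ0, abs_zero]; positivity
    · simpa [hτ0] using Metric.ball_mem_nhds _ hR
  refine ⟨_, inter_mem (e.open_source.mem_nhds hae) ((e.continuousAt hae).eventually hev), ?_⟩
  rintro u hu hu1 hub x ⟨hxD, hxs, hx⟩
  obtain ⟨hτx, hqx, hprojx⟩ := hx
  set z := e x with hz
  -- `q` is the point of the hypersurface below or above `z` in the direction of `Im z_n`.
  set q := z - ((τ z : ℂ) * Complex.I) • en with hq
  have hxz : e.symm z = x := e.left_inv hxs
  have hzq : z = q + ((τ z : ℂ) * Complex.I) • en := by simp [hq]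
  have hprojq : proj q = proj z := by
    conv_rhs => rw [hzq]
    exact (hproj_add _ _ (by simp)).symm
  have hqim : (q (Fin.last m)).im = h (proj q) := by
    have h1 := congrArg Complex.im (hlast q ((τ z : ℂ) * Complex.I))
    rw [← hzq] at h1
    simp only [Complex.add_im, Complex.mul_im, Complex.ofReal_re, Complex.I_im, mul_one,
      Complex.ofReal_im, Complex.I_re, mul_zero, add_zero] at h1
    rw [hprojq]
    have h2 : τ z = (z (Fin.last m)).im - h (proj z) := rfl
    linarith
  have hτne : τ z ≠ 0 := by
    intro h0
    refine hAfr _ (hSA z (e.map_source hxs) hprojx ?_) (by rwa [hxz])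
    have h2 : τ z = (z (Fin.last m)).im - h (proj z) := rfl
    linarith
  -- `σ` selects the side of the hypersurface.
  obtain ⟨σ, hσ1, hσ⟩ : ∃ σ : ℝ, |σ| = 1 ∧ 0 < σ * τ z := by
    rcases hτne.lt_or_gt with h0 | h0
    · exact ⟨-1, by simp, by linarith⟩
    · exact ⟨1, by simp, by linarith⟩
  have hσ0 : σ ≠ 0 := by
    rintro rfl
    simp at hσ1
  have hLc : Continuous fun w : ℂ => q + w • en := by fun_prop
  have hLT : ∀ w : ℂ, ‖w‖ < R → q + w • en ∈ T := by
    intro w hw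
    apply hball
    rw [mem_ball_iff_norm] at hqx ⊢
    calc ‖q + w • en - e a‖ = ‖(q - e a) + w • en‖ := by congr 1; abel
      _ ≤ ‖q - e a‖ + ‖w • en‖ := norm_add_le _ _
      _ < 2 * R := by rw [norm_smul, hen_norm]; linarith
  set Ω := e.target ∩ e.symm ⁻¹' (D ∩ N) with hΩ
  have hΩo : IsOpen Ω := e.isOpen_target_inter_symm_preimage (hD.inter hN)
  have hψc : ContinuousOn (fun w : ℂ => σ * τ (q + w • en)) (Metric.ball 0 R) := by
    refine continuousOn_const.mul (hτU.comp hLc.continuousOn fun w hw => ?_)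
    exact (hLT w (by simpa using hw)).2
  -- The part of the complex line through `q` in `D`, near `q` and on the side of `z`. It need not
  -- be connected.
  set G : Set ℂ := (Metric.ball 0 R ∩ (fun w : ℂ => σ * τ (q + w • en)) ⁻¹' Ioi 0) ∩
    (fun w : ℂ => q + w • en) ⁻¹' Ω with hG
  have hGo : IsOpen G :=
    (hψc.isOpen_inter_preimage Metric.isOpen_ball isOpen_Ioi).inter (hΩo.preimage hLc)
  have hGR : G ⊆ Metric.ball 0 R := fun w hw => hw.1.1
  have hzG : (τ z : ℂ) * Complex.I ∈ G := by
    refine ⟨⟨?_, ?_⟩, ?_⟩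
    · simpa using hτx.trans_le (min_le_left _ _)
    · simpa [← hzq] using hσ
    · simp only [mem_preimage, ← hzq]
      refine ⟨e.map_source hxs, ?_⟩
      have hzT := hLT ((τ z : ℂ) * Complex.I) (by simpa using hτx.trans_le (min_le_left _ _))
      rw [← hzq] at hzT
      have hzN : e.symm z ∈ N := hzT.1.2.2
      rw [hxz] at hzN
      simp only [mem_preimage, hxz]
      exact ⟨hxD, hzN⟩
  have hσsymm : ContinuousOn (fun w : ℂ => e.symm (q + w • en)) (Metric.ball 0 R) :=
    e.continuousOn_symm.comp hLc.continuousOn fun w hw => (hLT w (by simpa using hw)).1.1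
  have key := le_of_mem_slitPlane (v := fun w : ℂ => u (e.symm (q + w • en))) hGo hR hGR
    (κ := -Complex.I * σ) (by simp [hσ1]) ?_ ?_ ?_ ?_ ?_ hη hzG ?_
  · simpa only [← hzq, hxz] using key
  · intro w hw
    rw [Complex.mem_slitPlane_iff]
    by_cases hre : w.re = 0
    · left
      have h1 : τ (q + w • en) = w.im := by
        simp only [hτ, hlast, hproj_add q w hre, Complex.add_im, hqim]
        ring
      have h2 : 0 < σ * τ (q + w • en) := hw.1.2
      rw [h1] at h2
      simpa using h2
    · right
      simp [hσ0, hre]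
  · exact UpperSemicontinuousOn.comp (f := u ∘ e.symm) (upperSemicontinuousOn_comp_symm e hu.2.1) hLc.continuousOn
      fun w hw => hw.2
  · intro w hw
    exact hu1 _ hw.2.2
  · intro w hw
    obtain ⟨r, hr, hrG⟩ := Metric.nhds_basis_closedBall.mem_iff.1 (hGo.mem_nhds hw)
    refine ⟨r, hr, hrG, ?_⟩
    have h1 : HasSubMeanAt (u ∘ e.symm) (q + w • en) ((r : ℂ) • en) := by
      refine hu.2.2 e he _ _ fun ζ hζ => ?_
      have h2 : w + ζ * (r : ℂ) ∈ G := hrG (by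
        simpa using add_smul_mem_closedBall (z := w) (ξ := (r : ℂ)) (r := r)
          (by simp [abs_of_pos hr]) hζ)
      have h3 := h2.2
      simp only [mem_preimage] at h3
      rwa [add_smul, mul_smul, ← add_assoc] at h3
    exact h1.comp_line (v := u ∘ e.symm)
  · intro p hp hpR δ hδ
    have hpcl : p ∈ closure G := hp.1
    have hpG : p ∉ G := by rw [hGo.frontier_eq] at hp; exact hp.2
    have hpb : p ∈ Metric.ball (0 : ℂ) R := by simpa using hpR
    have hbnhds := Metric.isOpen_ball.mem_nhds hpb
    have hyT := hLT p hpR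
    have hcont : ContinuousAt (fun w : ℂ => e.symm (q + w • en)) p :=
      hσsymm.continuousAt hbnhds
    have hmaps : MapsTo (fun w : ℂ => e.symm (q + w • en)) G D := fun w hw => hw.2.2.1
    -- A boundary point of `G` in `D` would have height `0`, hence lie on `A`.
    have hyD : e.symm (q + p • en) ∉ D := by
      intro hyD
      refine hAfr _ (hSA _ hyT.1.1 hyT.2 ?_) hyD
      have h1 : 0 ≤ σ * τ (q + p • en) := by
        have h2 := (hψc.continuousAt hbnhds).continuousWithinAt.mem_closure hpcl
          (t := Ioi 0) fun w hw => hw.1.2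
        rwa [closure_Ioi] at h2
      have h2 : ¬ 0 < σ * τ (q + p • en) := fun h0 =>
        hpG ⟨⟨hpb, h0⟩, hyT.1.1, hyD, hyT.1.2.2⟩
      have h3 : σ * τ (q + p • en) = 0 := le_antisymm (not_lt.1 h2) h1
      have h4 : τ (q + p • en) = 0 := (mul_eq_zero.1 h3).resolve_left hσ0
      exact sub_eq_zero.1 h4
    have hyA : e.symm (q + p • en) ∈ A := by
      rw [hAO, hD.frontier_eq]
      exact ⟨hyT.1.2.1, hcont.continuousWithinAt.mem_closure hpcl hmaps, hyD⟩
    have htend : Tendsto (fun w : ℂ => e.symm (q + w • en)) (𝓝[G] p)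
        (𝓝[D] (e.symm (q + p • en))) :=
      hcont.continuousWithinAt.tendsto_nhdsWithin hmaps
    exact htend.eventually (hub _ ⟨hyA, hyT.1.2.2⟩ δ hδ)
  · simpa using (hτx.trans_le (min_le_right _ _)).le

end

theorem eventually_le_of_boundaryExt_le {X : Type*} [TopologicalSpace X] {D : Set X}
    {u : X → EReal} {b : X} (hb : b ∉ D) (h : boundaryExt D u b ≤ 0) {δ : ℝ} (hδ : 0 < δ) :
    ∀ᶠ z in 𝓝[D] b, u z ≤ (δ : EReal) := by
  simp only [boundaryExt, hb, if_false] at h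
  exact (eventually_lt_of_limsup_lt (h.trans_lt (by exact_mod_cast hδ))).mono fun _ h => h.le

theorem boundaryExt_le_of_eventually {X : Type*} [TopologicalSpace X] {D : Set X}
    {u : X → EReal} {b : X} (hb : b ∉ D)
    (h : ∀ δ : ℝ, 0 < δ → ∀ᶠ z in 𝓝[D] b, u z ≤ (δ : EReal)) : boundaryExt D u b ≤ 0 := by
  simp only [boundaryExt, hb, if_false]
  refine EReal.le_of_forall_lt_iff_le.1 fun t ht => limsup_le_of_le (h := h t ?_)
  exact_mod_cast ht

theorem uscReg_le_of_upperSemicontinuousOn {X : Type*} [TopologicalSpace X] {D : Set X}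
    {u s : X → EReal} (hs : UpperSemicontinuousOn s D) (hus : ∀ z ∈ D, u z ≤ s z) {z : X}
    (hz : z ∈ D) : uscReg D u z ≤ s z :=
  (limsup_le_limsup (eventually_nhdsWithin_of_forall hus)).trans
    (upperSemicontinuousOn_iff_limsup_le.1 hs z hz)

theorem UpperSemicontinuousOn.isOpen_inter_setOf_lt {X : Type*} [TopologicalSpace X] {D : Set X}
    {s : X → EReal} (hs : UpperSemicontinuousOn s D) (hD : IsOpen D) (c : EReal) :
    IsOpen {z ∈ D | s z < c} := by
  rw [isOpen_iff_mem_nhds]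
  rintro z ⟨hz, hzc⟩
  have h1 := upperSemicontinuousOn_iff.1 hs z hz c hzc
  rw [hD.nhdsWithin_eq hz] at h1
  exact inter_mem (hD.mem_nhds hz) h1

/-! ### The extremal function and comparison -/

section

variable {E : Type*} [NormedAddCommGroup E] [NormedSpace ℂ E]
  {X : Type*} [TopologicalSpace X] [ChartedSpace E X] {A D : Set X}

/-- The plurisubharmonic functions whose upper envelope is `extremalFun E A D`. -/
def extremalFamily (E : Type*) [NormedAddCommGroup E] [NormedSpace ℂ E]
    {X : Type*} [TopologicalSpace X] [ChartedSpace E X] (A D : Set X) : Set (X → EReal) :=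
  {u | IsPlurisubharmonicOn E u D ∧ (∀ w ∈ D, u w ≤ 1) ∧ ∀ a ∈ A, boundaryExt D u a ≤ 0}

theorem isLUB_extremalFun (z : X) :
    IsLUB ((fun u : X → EReal => u z) '' extremalFamily E A D) (extremalFun E A D z) := by
  have : {t : EReal | ∃ u : X → EReal, IsPlurisubharmonicOn E u D ∧ (∀ w ∈ D, u w ≤ 1) ∧
      (∀ a ∈ A, boundaryExt D u a ≤ 0) ∧ t = u z} =
      (fun u : X → EReal => u z) '' extremalFamily E A D := by
    ext t
    constructor
    · rintro ⟨u, h1, h2, h3, rfl⟩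
      exact ⟨u, ⟨h1, h2, h3⟩, rfl⟩
    · rintro ⟨u, ⟨h1, h2, h3⟩, rfl⟩
      exact ⟨u, h1, h2, h3, rfl⟩
  rw [extremalFun, this]
  exact isLUB_sSup _

theorem le_extremalFun {u : X → EReal} (hu : u ∈ extremalFamily E A D) (z : X) :
    u z ≤ extremalFun E A D z :=
  (isLUB_extremalFun z).1 ⟨u, hu, rfl⟩

theorem extremalFun_le {z : X} {c : EReal} (h : ∀ u ∈ extremalFamily E A D, u z ≤ c) :
    extremalFun E A D z ≤ c :=
  (isLUB_extremalFun z).2 (by rintro _ ⟨u, hu, rfl⟩; exact h u hu)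

theorem extremalFun_le_one {z : X} (hz : z ∈ D) : extremalFun E A D z ≤ 1 :=
  extremalFun_le fun _ hu => hu.2.1 z hz

theorem extremalFun_nonneg (hAD : ∀ a ∈ A, a ∉ D) (z : X) : 0 ≤ extremalFun E A D z := by
  have h0 : (fun _ : X => ((0 : ℝ) : EReal)) ∈ extremalFamily E A D := by
    refine ⟨isPlurisubharmonicOn_const 0, fun _ _ => by simp, fun a ha => ?_⟩
    refine boundaryExt_le_of_eventually (hAD a ha) fun δ hδ => Eventually.of_forall fun _ => ?_
    exact_mod_cast hδ.le
  simpa using le_extremalFun h0 z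

theorem pshMeasure_of_mem {z : X} (hz : z ∈ D) :
    pshMeasure E A D z = uscReg D (extremalFun E A D) z := by
  simp [pshMeasure, boundaryExt, hz]

theorem isPlurisubharmonicOn_uscReg_extremalFun (hD : IsOpen D) :
    IsPlurisubharmonicOn E (uscReg D (extremalFun E A D)) D :=
  isPlurisubharmonicOn_uscReg hD (M := 1) (fun _ hu => hu.1)
    (fun _ hz => by simpa using extremalFun_le_one hz) isLUB_extremalFun

theorem levelSet_eq (ε : ℝ) : levelSet E A D ε =
    {z ∈ D | uscReg D (extremalFun E A D) z < ((1 - ε : ℝ) : EReal)} := by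
  ext z
  refine and_congr_right fun hz => ?_
  rw [pshMeasure_of_mem hz]

theorem isOpen_levelSet (hD : IsOpen D) (ε : ℝ) : IsOpen (levelSet E A D ε) := by
  rw [levelSet_eq]
  exact (upperSemicontinuousOn_uscReg _).isOpen_inter_setOf_lt hD _

/-- Comparison principle: a plurisubharmonic function on an open subset `G` of `D` which at the
boundary of `G` inside `D` is dominated by the plurisubharmonic measure, and at `A` by `0`, lies
below the extremal function of `D`, since gluing makes it a competitor. -/
theorem le_extremalFun_of_frontier (hD : IsOpen D) (hAD : ∀ a ∈ A, a ∉ D)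
    (hA0 : ∀ a ∈ A, ∀ δ : ℝ, 0 < δ →
      ∀ᶠ z in 𝓝[D] a, uscReg D (extremalFun E A D) z ≤ (δ : EReal))
    {G : Set X} (hG : IsOpen G) {u : X → EReal} (hu : IsPlurisubharmonicOn E u G)
    {k : EReal} (hk : k ≤ 1) (huk : ∀ z ∈ G, u z ≤ k)
    (hfr : ∀ p ∈ D, p ∈ frontier G → k ≤ uscReg D (extremalFun E A D) p)
    (huA : ∀ a ∈ A, ∀ δ : ℝ, 0 < δ → ∀ᶠ z in 𝓝[G] a, u z ≤ (δ : EReal)) :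
    ∀ z ∈ G, u z ≤ extremalFun E A D z := by
  intro z hz
  refine (le_glueMax_of_mem (uscReg D (extremalFun E A D)) u hz).trans (le_extremalFun ?_ z)
  have h1 : ∀ w ∈ D, uscReg D (extremalFun E A D) w ≤ 1 := fun w _ =>
    uscReg_le (fun _ h => extremalFun_le_one h) w
  refine ⟨isPlurisubharmonicOn_glueMax hD hG (isPlurisubharmonicOn_uscReg_extremalFun hD) hu
    huk hfr, fun w hw => ?_, fun a ha => boundaryExt_le_of_eventually (hAD a ha) fun δ hδ => ?_⟩
  · unfold glueMax
    split_ifs with h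
    exacts [max_le (h1 w hw) ((huk w h).trans hk), h1 w hw]
  · filter_upwards [hA0 a ha δ hδ, nhdsWithin_le_nhds (eventually_nhdsWithin_iff.1 (huA a ha δ hδ))]
      with w hw1 hw2
    unfold glueMax
    split_ifs with h
    exacts [max_le hw1 (hw2 h), hw1]

variable [IsManifold 𝓘(ℂ, E) ω X]

/-- Identity theorem, in the form that the interior of the zero set of a holomorphic function is
relatively closed. -/
theorem eventually_eq_zero_of_mem_closure {G : Set X} (hG : IsOpen G) {f : X → ℂ}
    (hf : MDifferentiableOn 𝓘(ℂ, E) 𝓘(ℂ) f G) {z : X} (hz : z ∈ G)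
    (hcl : z ∈ closure {w | ∀ᶠ x in 𝓝 w, f x = 0}) : ∀ᶠ x in 𝓝 z, f x = 0 := by
  set e := chartAt E z with he
  have hmax : e ∈ IsManifold.maximalAtlas 𝓘(ℂ, E) ω X := IsManifold.chart_mem_maximalAtlas z
  have hze : z ∈ e.source := mem_chart_source E z
  have hd := hf.differentiableOn_comp_symm hmax
  obtain ⟨r, hr, hball⟩ := Metric.isOpen_iff.1 (e.isOpen_target_inter_symm_preimage hG) (e z)
    ⟨e.map_source hze, by simpa [e.left_inv hze] using hz⟩
  have hnhds : e.source ∩ e ⁻¹' Metric.ball (e z) r ∈ 𝓝 z :=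
    inter_mem (e.open_source.mem_nhds hze)
      ((e.continuousAt hze).preimage_mem_nhds (Metric.ball_mem_nhds _ hr))
  obtain ⟨w, ⟨hws, hwb⟩, hw⟩ := mem_closure_iff_nhds.1 hcl _ hnhds
  filter_upwards [hnhds] with x hx
  set F := f ∘ e.symm with hF
  have hF0 : ∀ᶠ y in 𝓝 (e w), F y = 0 := by
    have h1 : Tendsto e.symm (𝓝 (e w)) (𝓝 w) := by
      have := e.continuousAt_symm (e.map_source hws)
      rwa [ContinuousAt, e.left_inv hws] at this
    exact h1.eventually hw
  -- Restrict to the complex line through `w` and `x`.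
  set L : ℂ → E := fun t => e w + t • (e x - e w) with hL
  have hLc : Continuous L := by fun_prop
  have hLd : Differentiable ℂ L := by fun_prop
  have hopen : IsOpen (L ⁻¹' Metric.ball (e z) r) := Metric.isOpen_ball.preimage hLc
  have hconv : Convex ℝ (L ⁻¹' Metric.ball (e z) r) := by
    intro t₁ h₁ t₂ h₂ a b ha hb hab
    have h3 : L (a • t₁ + b • t₂) = a • L t₁ + b • L t₂ := by
      have h4 : e w = a • e w + b • e w := by rw [← add_smul, hab, one_smul]
      simp only [hL, add_smul, smul_add, smul_assoc]
      nth_rewrite 1 [h4]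
      abel
    simp only [mem_preimage, h3]
    exact convex_ball (e z) r h₁ h₂ ha hb hab
  have han : AnalyticOnNhd ℂ (F ∘ L) (L ⁻¹' Metric.ball (e z) r) :=
    ((hd.mono hball).comp hLd.differentiableOn fun _ h => h).analyticOnNhd hopen
  have h0 : (0 : ℂ) ∈ L ⁻¹' Metric.ball (e z) r := by simpa [hL] using hwb
  have h1 : (1 : ℂ) ∈ L ⁻¹' Metric.ball (e z) r := by simpa [hL] using hx.2
  have hev : F ∘ L =ᶠ[𝓝 0] 0 := by
    have h2 : Tendsto L (𝓝 0) (𝓝 (e w)) := by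
      have := hLc.tendsto 0
      simpa [hL] using this
    exact h2.eventually hF0
  have := han.eqOn_zero_of_preconnected_of_eventuallyEq_zero hconv.isPreconnected h0 hev h1
  simpa [hF, hL, e.left_inv hx.1] using this

end

/-! ### Behaviour at the hypersurface -/

section

variable {m : ℕ} {X : Type*} [TopologicalSpace X]
  [ChartedSpace (EuclideanSpace ℂ (Fin (m + 1))) X] {D A : Set X}

/-- The plurisubharmonic measure tends to `0` at the hypersurface. -/
theorem eventually_uscReg_extremalFun_le (hD : IsOpen D) (hA : IsRelOpen A (frontier D))
    (hA' : IsTopologicalHypersurface (m := m) A) (hAD : ∀ a ∈ A, a ∉ D) {a : X} (ha : a ∈ A)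
    {η : ℝ} (hη : 0 < η) :
    ∀ᶠ z in 𝓝[D] a,
      uscReg D (extremalFun (EuclideanSpace ℂ (Fin (m + 1))) A D) z ≤ (η : EReal) := by
  obtain ⟨N₁, hN₁, h⟩ := exists_nhds_forall_le hD hA hA' ha isOpen_univ (mem_univ a) hη
  have hle : ∀ z ∈ D ∩ N₁,
      extremalFun (EuclideanSpace ℂ (Fin (m + 1))) A D z ≤ (η : EReal) := fun z hz =>
    extremalFun_le fun u hu => h u (by simpa using hu.1) (by simpa using hu.2.1)
      (fun b hb δ hδ => eventually_le_of_boundaryExt_le (hAD b hb.1) (hu.2.2 b hb.1) hδ) z hz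
  filter_upwards [nhdsWithin_le_nhds (interior_mem_nhds.2 hN₁)] with z hz
  refine limsup_le_of_le (h := ?_)
  filter_upwards [self_mem_nhdsWithin,
    nhdsWithin_le_nhds (mem_interior_iff_mem_nhds.1 hz)] with w hwD hwN
  exact hle w ⟨hwD, hwN⟩

/-- Local boundary uniqueness: a holomorphic function with boundary values `0` on the hypersurface
vanishes near it. The functions `1 + (log |f|) / k` are all at most `1/2` close to the hypersurface,
on a neighbourhood that does not depend on `k`. -/
theorem eventually_eq_zero_of_tendsto_zero (hD : IsOpen D) (hA : IsRelOpen A (frontier D))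
    (hA' : IsTopologicalHypersurface (m := m) A) {a : X} (ha : a ∈ A) {N : Set X} (hN : IsOpen N)
    (haN : a ∈ N) {f : X → ℂ}
    (hf : MDifferentiableOn 𝓘(ℂ, EuclideanSpace ℂ (Fin (m + 1))) 𝓘(ℂ) f (D ∩ N))
    (hf1 : ∀ z ∈ D ∩ N, ‖f z‖ ≤ 1) (hf0 : ∀ b ∈ A ∩ N, Tendsto f (𝓝[D] b) (𝓝 0)) :
    ∀ᶠ z in 𝓝[D] a, f z = 0 := by
  obtain ⟨N₁, hN₁, h⟩ := exists_nhds_forall_le hD hA hA' ha hN haN one_half_pos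
  filter_upwards [self_mem_nhdsWithin, nhdsWithin_le_nhds hN₁] with z hzD hzN
  have hnorm : ∀ (k : ℕ) (w : X), ‖Complex.exp k * f w‖ = Real.exp k * ‖f w‖ := fun k w => by
    rw [norm_mul, Complex.norm_exp, Complex.natCast_re]
  have hkey : ∀ k : ℕ, 0 < k → ‖f z‖ ≤ Real.exp (-(k / 2 : ℝ)) := by
    intro k hk
    have hk' : (0 : ℝ) < (k : ℝ)⁻¹ := by positivity
    have hpsh : IsPlurisubharmonicOn (EuclideanSpace ℂ (Fin (m + 1)))
        (fun w => ENNReal.log ‖Complex.exp k * f w‖ₑ) (D ∩ N) :=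
      isPlurisubharmonicOn_log_enorm (f := fun w => Complex.exp k * f w)
        (MDifferentiableOn.mul mdifferentiableOn_const hf)
    have h1 := h _ (hpsh.const_mul hk') ?_ ?_ z ⟨hzD, hzN⟩
    · rw [EReal.coe_mul_le_coe_iff hk', ENNReal.log_enorm_le_coe_iff, hnorm, inv_inv,
        ← le_div_iff₀' (Real.exp_pos _), ← Real.exp_sub] at h1
      refine h1.trans (le_of_eq ?_)
      congr 1
      ring
    · intro w hw
      rw [← EReal.coe_one, EReal.coe_mul_le_coe_iff hk', ENNReal.log_enorm_le_coe_iff, hnorm,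
        inv_inv, mul_one]
      exact mul_le_of_le_one_right (Real.exp_pos _).le (hf1 w hw)
    · intro b hb δ hδ
      have h2 : ∀ᶠ w in 𝓝[D] b, ‖f w‖ < Real.exp (-k) :=
        (hf0 b hb).norm.eventually_lt_const (by simpa using Real.exp_pos _)
      filter_upwards [h2] with w hw
      rw [EReal.coe_mul_le_coe_iff hk', ENNReal.log_enorm_le_coe_iff, hnorm, inv_inv]
      calc Real.exp k * ‖f w‖ ≤ Real.exp k * Real.exp (-k) := by gcongr
        _ = Real.exp 0 := by rw [← Real.exp_add, add_neg_cancel]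
        _ ≤ _ := Real.exp_le_exp.2 (by positivity)
  have hlim : Tendsto (fun k : ℕ => Real.exp (-(k / 2 : ℝ))) atTop (𝓝 0) :=
    Real.tendsto_exp_neg_atTop_nhds_zero.comp
      (tendsto_natCast_atTop_atTop.atTop_div_const two_pos)
  have h0 : ‖f z‖ ≤ 0 := ge_of_tendsto hlim ((eventually_gt_atTop 0).mono hkey)
  simpa using h0

end

/-! ### Level sets of the plurisubharmonic measure -/

theorem proposition3p7 {m : ℕ} {X : Type*} [TopologicalSpace X] [T2Space X]
    [ChartedSpace (EuclideanSpace ℂ (Fin (m + 1))) X]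
    [IsManifold 𝓘(ℂ, EuclideanSpace ℂ (Fin (m + 1))) ω X]
    (D A : Set X) (hD : IsOpen D) (hA : IsRelOpen A (frontier D))
    (hA' : IsTopologicalHypersurface (m := m) A)
    (ε : ℝ) (hε₀ : 0 ≤ ε) (hε₁ : ε < 1) :
    (IsRelOpen A (frontier (levelSet (EuclideanSpace ℂ (Fin (m + 1))) A D ε)) ∧
      ∀ ζ ∈ A, Tendsto (pshMeasure (EuclideanSpace ℂ (Fin (m + 1))) A D) (𝓝[D ∪ A] ζ) (𝓝 0)) ∧
    (∀ z ∈ levelSet (EuclideanSpace ℂ (Fin (m + 1))) A D ε,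
      pshMeasure (EuclideanSpace ℂ (Fin (m + 1))) A
          (levelSet (EuclideanSpace ℂ (Fin (m + 1))) A D ε) z =
        pshMeasure (EuclideanSpace ℂ (Fin (m + 1))) A D z / ((1 - ε : ℝ) : EReal)) ∧
    (∀ f : X → ℂ,
      MDifferentiableOn 𝓘(ℂ, EuclideanSpace ℂ (Fin (m + 1))) 𝓘(ℂ) f
        (levelSet (EuclideanSpace ℂ (Fin (m + 1))) A D ε) →
      (∀ ζ ∈ A, Tendsto f (𝓝[levelSet (EuclideanSpace ℂ (Fin (m + 1))) A D ε] ζ) (𝓝 0)) →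
      ∀ z ∈ levelSet (EuclideanSpace ℂ (Fin (m + 1))) A D ε, f z = 0) := by
  set E := EuclideanSpace ℂ (Fin (m + 1)) with hE
  have hAD : ∀ x ∈ A, x ∉ D := by
    obtain ⟨O, _, rfl⟩ := hA
    intro x hx
    rw [hD.frontier_eq] at hx
    exact hx.2.2
  have hAcl : ∀ x ∈ A, x ∈ closure D := by
    obtain ⟨O, _, rfl⟩ := hA
    exact fun x hx => hx.2.1
  set s := uscReg D (extremalFun E A D) with hs
  set Dε := levelSet E A D ε with hDε
  have hspsh : IsPlurisubharmonicOn E s D := isPlurisubharmonicOn_uscReg_extremalFun hD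
  have hs0 : ∀ a ∈ A, ∀ δ : ℝ, 0 < δ → ∀ᶠ z in 𝓝[D] a, s z ≤ (δ : EReal) :=
    fun a ha δ hδ => eventually_uscReg_extremalFun_le hD hA hA' hAD ha hδ
  have hsnn : ∀ z ∈ D, 0 ≤ s z := fun z hz => (extremalFun_nonneg hAD z).trans (le_uscReg _ hz)
  have hDεo : IsOpen Dε := isOpen_levelSet hD ε
  have hmem : ∀ z, z ∈ Dε ↔ z ∈ D ∧ s z < ((1 - ε : ℝ) : EReal) := fun z => by
    rw [hDε, levelSet_eq]; rfl
  have hDεD : Dε ⊆ D := fun z hz => hz.1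
  have hc : 0 < 1 - ε := sub_pos.2 hε₁
  have hnear : ∀ a ∈ A, ∀ᶠ z in 𝓝 a, z ∈ D → z ∈ Dε := by
    intro a ha
    have h1 := hs0 a ha ((1 - ε) / 2) (by positivity)
    rw [eventually_nhdsWithin_iff] at h1
    filter_upwards [h1] with z hz hzD
    refine (hmem z).2 ⟨hzD, (hz hzD).trans_lt ?_⟩
    norm_cast
    linarith
  have hfrε : ∀ p ∈ D, p ∉ Dε → ((1 - ε : ℝ) : EReal) ≤ s p := by
    intro p hp hpε
    by_contra hlt
    exact hpε ((hmem p).2 ⟨hp, not_le.1 hlt⟩)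
  have hc1 : ((1 - ε : ℝ) : EReal) ≤ 1 := by
    rw [← EReal.coe_one, EReal.coe_le_coe_iff]
    linarith
  refine ⟨⟨?_, ?_⟩, ?_, ?_⟩
  · -- `D` and `D_ε` coincide near each point of `A`, hence so do their boundaries.
    obtain ⟨O, hO, hAO⟩ := hA
    set V := interior {x | x ∈ D → x ∈ Dε} with hV
    have hAV : A ⊆ V := fun a ha => mem_interior_iff_mem_nhds.2 (hnear a ha)
    refine ⟨O ∩ V, hO.inter isOpen_interior, Subset.antisymm ?_ ?_⟩
    · intro a ha
      refine ⟨⟨?_, hAV ha⟩, ?_⟩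
      · rw [hAO] at ha; exact ha.1
      · rw [hDεo.frontier_eq]
        refine ⟨?_, fun h => hAD a ha (hDεD h)⟩
        refine closure_mono ?_ (isOpen_interior.inter_closure ⟨hAV ha, hAcl a ha⟩)
        exact fun x hx => (interior_subset hx.1 : x ∈ D → x ∈ Dε) hx.2
    · rintro x ⟨⟨hxO, hxV⟩, hx⟩
      rw [hDεo.frontier_eq] at hx
      rw [hAO, hD.frontier_eq]
      refine ⟨hxO, closure_mono hDεD hx.1, fun hxD => hx.2 ?_⟩
      exact (interior_subset hxV : x ∈ D → x ∈ Dε) hxD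
  · intro ζ hζ
    rw [nhdsWithin_union, tendsto_sup]
    constructor
    · refine tendsto_order.2 ⟨fun b hb => ?_, fun b hb => ?_⟩
      · filter_upwards [self_mem_nhdsWithin] with z hz
        rw [pshMeasure_of_mem hz]
        exact hb.trans_le (hsnn z hz)
      · obtain ⟨t, ht0, htb⟩ := EReal.lt_iff_exists_real_btwn.1 hb
        filter_upwards [self_mem_nhdsWithin, hs0 ζ hζ t (by exact_mod_cast ht0)] with z hz hzt
        rw [pshMeasure_of_mem hz]
        exact hzt.trans_lt htb
    · refine tendsto_const_nhds.congr' ?_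
      filter_upwards [self_mem_nhdsWithin] with b hb
      refine (le_antisymm (boundaryExt_le_of_eventually (hAD b hb) (hs0 b hb)) ?_).symm
      have : (𝓝[D] b).NeBot := mem_closure_iff_nhdsWithin_neBot.1 (hAcl b hb)
      simp only [boundaryExt, hAD b hb, if_false]
      refine le_limsup_of_frequently_le (Eventually.frequently ?_)
      exact eventually_nhdsWithin_of_forall hsnn
  · intro z hz
    have hc' : 0 < (1 - ε)⁻¹ := inv_pos.2 hc
    have hdiv : ∀ x : EReal, x / ((1 - ε : ℝ) : EReal) = (((1 - ε)⁻¹ : ℝ) : EReal) * x := by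
      intro x
      rw [EReal.div_eq_inv_mul, EReal.coe_inv]
    rw [pshMeasure_of_mem hz, pshMeasure_of_mem (hDεD hz), hdiv]
    have hpsh : IsPlurisubharmonicOn E (fun w => (((1 - ε)⁻¹ : ℝ) : EReal) * s w) Dε :=
      (hspsh.mono hDεD).const_mul hc'
    apply le_antisymm
    · refine uscReg_le_of_upperSemicontinuousOn hpsh.2.1 (fun w hw => ?_) hz
      refine extremalFun_le fun u hu => ?_
      have h1 := le_extremalFun_of_frontier hD hAD hs0 hDεo (hu.1.const_mul hc) hc1
        (fun x hx => ?_) (fun p hp hpf => hfrε p hp ?_) (fun a ha δ hδ => ?_) w hw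
      · have h2 := h1.trans (le_uscReg _ (hDεD hw))
        rw [← hdiv]
        rw [EReal.le_div_iff_mul_le (by exact_mod_cast hc) (EReal.coe_ne_top _), mul_comm]
        exact h2
      · rw [EReal.coe_mul_le_coe_iff hc, inv_mul_cancel₀ hc.ne', EReal.coe_one]
        exact hu.2.1 x hx
      · rw [hDεo.frontier_eq] at hpf
        exact hpf.2
      · have h2 := eventually_le_of_boundaryExt_le (fun h => hAD a ha (hDεD h)) (hu.2.2 a ha)
          (δ := (1 - ε)⁻¹ * δ) (by positivity)
        exact h2.mono fun x hx => (EReal.coe_mul_le_coe_iff hc).2 hx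
    · refine le_trans (le_extremalFun (A := A) ⟨hpsh, fun w hw => ?_, fun a ha => ?_⟩ z)
        (le_uscReg _ hz)
      · rw [← EReal.coe_one, EReal.coe_mul_le_coe_iff hc', inv_inv, mul_one]
        exact ((hmem w).1 hw).2.le
      · refine boundaryExt_le_of_eventually (fun h => hAD a ha (hDεD h)) fun δ hδ => ?_
        have h2 := hs0 a ha (((1 - ε)⁻¹)⁻¹ * δ) (by positivity)
        exact (h2.filter_mono (nhdsWithin_mono a hDεD)).mono fun x hx =>
          (EReal.coe_mul_le_coe_iff hc').2 hx
  · intro f hf hf0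
    set Z := {w | ∀ᶠ x in 𝓝 w, f x = 0} with hZ
    have hZo : IsOpen Z := isOpen_setOfPred_eventually_nhds
    -- The part of `D_ε` where `f` does not vanish identically; the comparison principle, applied
    -- to the constant `1 - ε`, shows that it is empty.
    set W := Dε \ closure Z with hW
    have hWo : IsOpen W := hDεo.sdiff isClosed_closure
    have hWA : ∀ a ∈ A, ∀ᶠ z in 𝓝 a, z ∉ W := by
      intro a ha
      have h1 : ∀ᶠ z in 𝓝 a, z ∈ Dε → ‖f z‖ < 1 := by
        rw [← eventually_nhdsWithin_iff]
        exact (hf0 a ha).norm.eventually_lt_const (by simp)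
      obtain ⟨N, hNsub, hN, haN⟩ := eventually_nhds_iff.1 ((hnear a ha).and h1)
      have hsub : D ∩ N ⊆ Dε := fun z hz => (hNsub z hz.2).1 hz.1
      have h2 := eventually_eq_zero_of_tendsto_zero hD hA hA' ha hN haN (hf.mono hsub)
        (fun z hz => ((hNsub z hz.2).2 (hsub hz)).le) fun b hb => by
          refine (hf0 b hb.1).mono_left ?_
          rw [nhdsWithin_le_iff]
          filter_upwards [self_mem_nhdsWithin, nhdsWithin_le_nhds (hnear b hb.1)] with x hx1 hx2
          exact hx2 hx1
      obtain ⟨N', hN'sub, hN', haN'⟩ := eventually_nhds_iff.1 (eventually_nhdsWithin_iff.1 h2)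
      filter_upwards [hN'.mem_nhds haN'] with z hzN' hzW
      refine hzW.2 (subset_closure ?_)
      filter_upwards [hD.mem_nhds (hDεD hzW.1), hN'.mem_nhds hzN'] with x hxD hxN'
      exact hN'sub x hxN' hxD
    have hWempty : ∀ z, z ∉ W := by
      intro z hz
      have h1 := le_extremalFun_of_frontier (E := E) (u := fun _ => ((1 - ε : ℝ) : EReal)) hD hAD
        hs0 hWo (isPlurisubharmonicOn_const _) hc1 (fun _ _ => le_rfl)
        (fun p hp hpf => hfrε p hp fun hpε => ?_) (fun a ha δ _ => ?_) z hz
      · exact absurd ((hmem z).1 hz.1).2 (not_lt.2 (h1.trans (le_uscReg _ (hDεD hz.1))))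
      · rw [hWo.frontier_eq] at hpf
        have hpZ : p ∈ closure Z := by
          by_contra h
          exact hpf.2 ⟨hpε, h⟩
        have hpZ' : p ∈ Z := eventually_eq_zero_of_mem_closure hDεo hf hpε hpZ
        obtain ⟨x, hxZ, hxW⟩ := mem_closure_iff.1 hpf.1 Z hZo hpZ'
        exact hxW.2 (subset_closure hxZ)
      · filter_upwards [self_mem_nhdsWithin, nhdsWithin_le_nhds (hWA a ha)] with x hx1 hx2
        exact absurd hx1 hx2
    intro z hz
    have hzcl : z ∈ closure Z := by
      by_contra h
      exact hWempty z ⟨hz, h⟩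
    exact (eventually_eq_zero_of_mem_closure hDεo hf hz hzcl).self_of_nhds
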